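/- Nodes form a homogeneous Poisson point process with density $\lambda>0$ on a Borel region $\mathcal A\subset\mathbb R^2$ of finite area. A drone hovers at altitude $h>0$ above the centre $c$ of a closed disk $\mathcal A_\mu\subseteq\mathcal A$ of radius $R>0$; put $d=\sqrt{h^2+R^2}$ and $D_x=\sqrt{|x-c|^2+h^2}$. In a given slot each node in $\mathcal A_\mu$ transmits with probability $a\in[0,1]$; $\tilde\Psi_\mu$ denotes the set of transmitting nodes of $\mathcal A_\mu$. Each node $x$ has a Gamma distributed gain $G_x$ with density $m^m g^{m-1}e^{-mg}/\Gamma(m)$, $g>0$, where $m\ge 1$ is an integer. All transmission decisions and gains are independent of each other and of the node positions. With transmission power $P>0$, path loss exponent $\eta>0$ and noise variance $\sigma_n^2>0$, put for $x\in\tilde\Psi_\mu$ $$\mathrm{SINR}_x=\frac{P G_xD_x^{-\eta}}{\sum_{y\in\tilde\Psi_\mu\setminus\{x\}}P G_yD_y^{-\eta}+\sigma_n^2},\qquad I_x=\sum_{y\in\tilde\Psi_\mu\setminus\{x\}}G_yD_y^{-\eta}+\frac{\sigma_n^2}{P},$$ $$\mathcal L_I(s)=e^{-s\sigma_n^2/P}\exp\Big(-2\pi\lambda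 a\int_h^d\Big(1-\big(1+\tfrac{s r^{-\eta}}{m}\big)^{-m}\Big)r\,dr\Big).$$ Let $\mathcal A_{int}=\mathcal A_{mse}\cap\mathcal A_\mu$, where $\mathcal A_{mse}$ is the closed disk of radius $R_{mse}>0$ centred at a point of the boundary circle of $\mathcal A_\mu$. Theorem. For every SINR threshold $\beta\ge 1$, the probability of a successful transmission from $\mathcal A_{int}$, that is, the probability $P_e^s$ that some $x\in\tilde\Psi_\mu\cap\mathcal A_{int}$ has $\mathrm{SINR}_x\ge\beta$, is $$P_e^s=a\lambda\int_h^d\ \sum_{k=0}^{m-1}\frac{(-m\beta r^\eta)^k}{k!}\Big[\frac{\partial^k}{\partial s^k}\mathcal L_I(s)\Big]_{s=m\beta r^\eta}\, r\,\theta\big(\sqrt{r^2-h^2}\big)\,dr,$$ where $$\theta(w)=\begin{cases}2\pi,&0\le w\le\max(0,R_{mse}-R),\\ 2\arccos\Big(\dfrac{R^2+w^2-R_{mse}^2}{2Rw}\Big),&|R_{mse}-R|\le w\le R_{mse}+R\text{ (and the first case does not apply)},\\ 0,&\text{otherwise.}\end{cases}$$ Here $\mathcal L_I$ is the Laplace transform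 of the normalized interference plus noise seen by the signal of an active node: for all $s\ge 0$ and all Borel sets $B\subseteq\mathcal A_\mu$, with $|B|$ the area of $B$, $$\mathbb E\sum_{x\in\tilde\Psi_\mu\cap B}e^{-sI_x}=a\lambda\,|B|\,\mathcal L_I(s).$$ -/

import Mathlib

open MeasureTheory ProbabilityTheory

noncomputable section

namespace UAV

/-- The ground plane with its Euclidean distance and Lebesgue measure. -/
abbrev Plane : Type := EuclideanSpace ℝ (Fin 2)

open Classical in
/-- The number of points of the finite configuration `X 0, …, X (n - 1)` that lie in `B`. -/
def countIn (n : ℕ) (X : ℕ → Plane) (B : Set Plane) : ℕ :=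
  ((Finset.range n).filter (fun i => X i ∈ B)).card

/-- The random configuration `X 0 ω, …, X (N ω - 1) ω` is a homogeneous Poisson point process
with density `lam` on the region `𝒜`: the number of points in a Borel set `B` has the Poisson
law with mean `lam * |B ∩ 𝒜|`, and the numbers of points in disjoint Borel sets are
independent. -/
structure IsHomogeneousPPP {Ω : Type*} [MeasurableSpace Ω] (Pr : Measure Ω)
    (lam : ℝ) (𝒜 : Set Plane) (N : Ω → ℕ) (X : ℕ → Ω → Plane) : Prop where
  measurable_number : Measurable N
  measurable_position : ∀ i, Measurable (X i)
  count_law : ∀ B : Set Plane, MeasurableSet B →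
    Pr.map (fun ω => countIn (N ω) (fun i => X i ω) B) =
      poissonMeasure (lam * volume.real (B ∩ 𝒜)).toNNReal
  count_indep : ∀ (n : ℕ) (B : Fin n → Set Plane), (∀ j, MeasurableSet (B j)) →
    Pairwise (fun j l => Disjoint (B j) (B l)) →
    iIndepFun (fun j ω => countIn (N ω) (fun i => X i ω) (B j)) Pr

/-- One slot of the network. The nodes form a homogeneous Poisson point process; node `i`
transmits (`T i = true`) with probability `a` and has a Gamma distributed power gain `G i` with
density `m ^ m * g ^ (m - 1) / Γ(m) * exp (-m * g)`. All these decisions and gains are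
independent of one another and of the node positions. -/
structure IsSlot {Ω : Type*} [MeasurableSpace Ω] (Pr : Measure Ω)
    (lam a : ℝ) (m : ℕ) (𝒜 : Set Plane)
    (N : Ω → ℕ) (X : ℕ → Ω → Plane) (T : ℕ → Ω → Bool) (G : ℕ → Ω → ℝ) : Prop where
  nodes : IsHomogeneousPPP Pr lam 𝒜 N X
  measurable_decision : ∀ i, Measurable (T i)
  measurable_gain : ∀ i, Measurable (G i)
  decision_law : ∀ i, Pr.real {ω | T i ω = true} = a
  gain_law : ∀ i, Pr.map (G i) = gammaMeasure m m
  decision_indep_gain : ∀ i, IndepFun (T i) (G i) Pr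
  marks_indep : iIndepFun (fun i ω => (T i ω, G i ω)) Pr
  marks_indep_nodes :
    IndepFun (fun ω => (N ω, fun i => X i ω)) (fun ω i => (T i ω, G i ω)) Pr

/-- The distance between a ground node at `x` and the drone at altitude `h` above `c`. -/
def droneDist (c : Plane) (h : ℝ) (x : Plane) : ℝ := √(dist x c ^ 2 + h ^ 2)

open Classical in
/-- The indices of the nodes that lie in the hovering disk (centre `c`, radius `R`) and transmit:
the active nodes of the slot. -/
def active (c : Plane) (R : ℝ) (n : ℕ) (X : ℕ → Plane) (T : ℕ → Bool) : Finset ℕ :=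
  (Finset.range n).filter (fun i => X i ∈ Metric.closedBall c R ∧ T i = true)

/-- Signal to interference plus noise ratio of node `i` when `S` is the set of active nodes,
`Pt` the transmission power, `η` the path loss exponent and `σ2` the noise variance. -/
def sinr (Pt η σ2 : ℝ) (c : Plane) (h : ℝ) (S : Finset ℕ) (X : ℕ → Plane) (G : ℕ → ℝ)
    (i : ℕ) : ℝ :=
  Pt * G i * droneDist c h (X i) ^ (-η) /
    (∑ j ∈ S.erase i, Pt * G j * droneDist c h (X j) ^ (-η) + σ2)

/-- Interference plus noise seen by the signal of node `i`, normalized by the transmission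
power. -/
def interference (Pt η σ2 : ℝ) (c : Plane) (h : ℝ) (S : Finset ℕ) (X : ℕ → Plane) (G : ℕ → ℝ)
    (i : ℕ) : ℝ :=
  ∑ j ∈ S.erase i, G j * droneDist c h (X j) ^ (-η) + σ2 / Pt

/-- The closed form of the Laplace transform of the normalized interference plus noise. -/
def laplaceI (lam a Pt η σ2 h R : ℝ) (m : ℕ) (s : ℝ) : ℝ :=
  Real.exp (-s * σ2 / Pt) *
    Real.exp (-2 * Real.pi * lam * a *
      ∫ r in h..√(h ^ 2 + R ^ 2), (1 - (1 + s * r ^ (-η) / m) ^ (-(m : ℤ))) * r)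

/-- The angular factor of the intersection of a disk of radius `R` with a disk of radius `Rmse`
centred on its edge, at distance `w` from the centre of the first disk. -/
def theta (R Rmse w : ℝ) : ℝ :=
  if 0 ≤ w ∧ w ≤ max 0 (Rmse - R) then 2 * Real.pi
  else if |Rmse - R| ≤ w ∧ w ≤ Rmse + R then
    2 * Real.arccos ((R ^ 2 + w ^ 2 - Rmse ^ 2) / (2 * R * w))
  else 0

end UAV

end

noncomputable section

namespace UAV

open Filter Topology

/-! A node whose SINR is at least `β ≥ 1` receives more power than any other active node, so at most
one node succeeds (`eq_of_le_sinr`). The success probability is therefore the expected number of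
successful active nodes in the lens, and this is additive over nodes.

Success of a node means that its own gain exceeds `β D ^ η I`. This gain is independent of the
node's position, its activity and the interference `I` it sees. Integrating it out
(`IsSlot.lintegral_sum_active_gain`) leaves the Gamma tail, integrated against the Campbell measure
of the pairs (position, interference).

The main point is that this measure is a product of area on the hovering disk and a measure `ν` on
`[0, ∞)` with Laplace transform `a * lam * laplaceI` (`IsSlot.exists_activeMeasure_eq_prod`). To see
this, differentiate the probability generating functional of the Poisson process in the direction of
an indicator, which gives the reduced Campbell formula `integral_sum_prod_erase`. With the marks
averaged out it yields the transform of the interference seen from any Borel part `B` of the disk,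
which is the second claim. It depends on `B` only through its area, and `measure_ext_of_laplace`
turns this into the product structure.

For integer shape the Gamma tail is a finite sum of terms `t ^ k * exp (-m * t)` with coefficients
(`gammaMeasure_Ici`), so its `ν`-integral is a sum of derivatives of the Laplace transform
(`integral_gammaTail`). Polar coordinates about `c`, followed by `r = √(w ^ 2 + h ^ 2)`, produce the
radial integral and the angle `theta` (`lintegral_lens`). -/

lemma hasSum_pow_poisson (r : NNReal) (z : ℝ) :
    HasSum (fun k : ℕ => Real.exp (-r) * r ^ k / (k.factorial : ℝ) * z ^ k)
      (Real.exp (r * (z - 1))) := by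
  have h := (NormedSpace.expSeries_div_hasSum_exp ((r : ℝ) * z)).mul_left (Real.exp (-r))
  rw [← Real.exp_eq_exp_ℝ, ← Real.exp_add] at h
  have e1 : (r : ℝ) * (z - 1) = -r + r * z := by ring
  rw [e1]
  refine h.congr_fun fun k => ?_
  rw [mul_pow]; ring

lemma lhasSum_pow_poisson (r : NNReal) {z : ℝ} (hz : 0 ≤ z) :
    ∫⁻ k, ENNReal.ofReal (z ^ k) ∂(poissonMeasure r) = ENNReal.ofReal (Real.exp (r * (z - 1))) := by
  have h := hasSum_pow_poisson r z
  rw [lintegral_countable', ← h.tsum_eq, ENNReal.ofReal_tsum_of_nonneg (fun k => by positivity)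
    h.summable]
  congr 1; ext k
  rw [poissonMeasure_singleton, ← ENNReal.ofReal_mul (by positivity), mul_comm]

open Classical in
-- Grouping the points by the value of `w` leaves only counts in level sets, the quantities whose
-- joint law the Poisson axioms describe.
lemma prod_range_eq_prod_countIn {n : ℕ} (w : SimpleFunc Plane ℝ) (x : ℕ → Plane) :
    ∏ i ∈ Finset.range n, w (x i) = ∏ v ∈ w.range, v ^ countIn n x (w ⁻¹' {v}) := by
  rw [← Finset.prod_fiberwise_of_maps_to (g := fun i => w (x i)) (t := w.range)
    (fun i _ => w.mem_range_self _)]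
  refine Finset.prod_congr rfl fun v _ => ?_
  rw [Finset.prod_congr rfl (g := fun _ => v) (fun i hi => (Finset.mem_filter.1 hi).2),
    Finset.prod_const]
  simp [countIn]

lemma prod_range_le_pow (n : ℕ) {f : ℕ → ℝ} {M : ℝ} (hf : ∀ i, f i ∈ Set.Icc 0 M) :
    ∏ i ∈ Finset.range n, f i ≤ M ^ n := by
  simpa using Finset.prod_le_prod (s := Finset.range n) (fun i _ => (hf i).1) fun i _ => (hf i).2

lemma countIn_univ (n : ℕ) (x : ℕ → Plane) : countIn n x Set.univ = n := by
  simp [countIn]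

/-! ### Generating functional and reduced Campbell formula of the Poisson process -/

section PoissonProcess

variable {Ω : Type*} [MeasurableSpace Ω] {Pr : Measure Ω} {lam : ℝ} {𝒜 : Set Plane}
  {N : Ω → ℕ} {X : ℕ → Ω → Plane}

/-- The random number of points takes countably many values, so measurability can be checked with it
frozen. -/
lemma measurable_of_measurable_fixed_count {β : Type*} [MeasurableSpace β] (hN : Measurable N)
    {f : ℕ → Ω → β} (hf : ∀ n, Measurable (f n)) : Measurable (fun ω => f (N ω) ω) := by
  have : Measurable (fun p : ℕ × Ω => f p.1 p.2) := measurable_from_prod_countable_right hf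
  exact this.comp (hN.prodMk measurable_id)

lemma measurable_countIn (h : IsHomogeneousPPP Pr lam 𝒜 N X) {B : Set Plane}
    (hB : MeasurableSet B) : Measurable (fun ω => countIn (N ω) (fun i => X i ω) B) := by
  classical
  refine measurable_of_measurable_fixed_count h.measurable_number
    (f := fun n ω => countIn n (fun i => X i ω) B) fun n => ?_
  simp only [countIn, Finset.card_filter]
  refine Finset.measurable_fun_sum _ fun i _ => ?_
  exact Measurable.ite (h.measurable_position i hB) measurable_const measurable_const

lemma lintegral_pow_number (h : IsHomogeneousPPP Pr lam 𝒜 N X) {z : ℝ} (hz : 0 ≤ z) :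
    ∫⁻ ω, ENNReal.ofReal (z ^ N ω) ∂Pr ≠ ⊤ := by
  have h1 := h.count_law Set.univ MeasurableSet.univ
  simp only [countIn_univ] at h1
  rw [← lintegral_map (f := fun k : ℕ => ENNReal.ofReal (z ^ k)) (measurable_of_countable _)
    h.measurable_number, h1, lhasSum_pow_poisson _ hz]
  exact ENNReal.ofReal_ne_top

/-- Supplies the dominating functions for all limits and derivatives taken under the expectation
over the process. -/
lemma integrable_pow_number (h : IsHomogeneousPPP Pr lam 𝒜 N X) {z : ℝ} (hz : 0 ≤ z) :
    Integrable (fun ω => z ^ N ω) Pr := by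
  have hm : Measurable (fun ω => z ^ N ω) :=
    (measurable_of_countable (fun k : ℕ => z ^ k)).comp h.measurable_number
  refine ⟨hm.aestronglyMeasurable, ?_⟩
  rw [hasFiniteIntegral_iff_ofReal (ae_of_all _ fun ω => by positivity)]
  exact (lintegral_pow_number h hz).lt_top

lemma measurable_prod_position (h : IsHomogeneousPPP Pr lam 𝒜 N X) {w : Plane → ℝ}
    (hw : Measurable w) : Measurable (fun ω => ∏ i ∈ Finset.range (N ω), w (X i ω)) :=
  measurable_of_measurable_fixed_count h.measurable_number
    (f := fun k ω => ∏ i ∈ Finset.range k, w (X i ω))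
    fun _ => Finset.measurable_fun_prod _ fun i _ => hw.comp (h.measurable_position i)

/-- The level sets of `w` are disjoint, so their counts are independent Poisson variables. The
expectation factors into Poisson generating functions, whose exponents add up to the integral of `w
- 1`. -/
lemma integral_prod_simpleFunc (h : IsHomogeneousPPP Pr lam 𝒜 N X) (hlam : 0 ≤ lam)
    (h𝒜fin : volume 𝒜 ≠ ⊤) (w : SimpleFunc Plane ℝ) (hw0 : ∀ x, 0 ≤ w x) :
    ∫ ω, ∏ i ∈ Finset.range (N ω), w (X i ω) ∂Pr =
      Real.exp (lam * ∫ x in 𝒜, (w x - 1)) := by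
  classical
  have : IsFiniteMeasure (volume.restrict 𝒜) := ⟨by simpa using h𝒜fin.lt_top⟩
  have hr0 : ∀ v ∈ w.range, 0 ≤ v := by
    intro v hv
    obtain ⟨x, rfl⟩ := SimpleFunc.mem_range.1 hv
    exact hw0 x
  have hint : Integrable w (volume.restrict 𝒜) := SimpleFunc.integrable_of_isFiniteMeasure w
  rw [integral_eq_lintegral_of_nonneg_ae
    (ae_of_all _ fun ω => Finset.prod_nonneg fun i _ => hw0 _)
    (measurable_prod_position h w.measurable).aestronglyMeasurable]
  set e := w.range.equivFin
  set B : Fin w.range.card → Set Plane := fun j => w ⁻¹' {(e.symm j : ℝ)}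
  have hB : ∀ j, MeasurableSet (B j) := fun j => w.measurableSet_preimage _
  have hdisj : Pairwise (fun j l => Disjoint (B j) (B l)) := by
    intro j l hjl
    refine Set.disjoint_left.2 fun x hx hx' => hjl ?_
    apply e.symm.injective
    apply Subtype.ext
    rw [← show w x = _ from hx, ← show w x = _ from hx']
  have hind := (h.count_indep _ B hB hdisj).comp
    (fun j (k : ℕ) => ENNReal.ofReal ((e.symm j : ℝ) ^ k)) (fun j => measurable_of_countable _)
  have hprod : ∀ ω, ENNReal.ofReal (∏ i ∈ Finset.range (N ω), w (X i ω)) =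
      ∏ j : Fin w.range.card, ((fun k : ℕ => ENNReal.ofReal ((e.symm j : ℝ) ^ k)) ∘
        fun ω => countIn (N ω) (fun i => X i ω) (B j)) ω := by
    intro ω
    rw [prod_range_eq_prod_countIn w (fun i => X i ω), ENNReal.ofReal_prod_of_nonneg
      (fun v hv => pow_nonneg (hr0 v hv) _), ← Finset.prod_coe_sort,
      ← e.symm.prod_comp]
    rfl
  simp_rw [hprod]
  rw [lintegral_prod_eq_prod_lintegral_of_indepFun _ _ hind
    (fun j => (measurable_of_countable _).comp (measurable_countIn h (hB j)))]
  have hone : ∀ j, ∫⁻ ω, ((fun k : ℕ => ENNReal.ofReal ((e.symm j : ℝ) ^ k)) ∘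
        fun ω => countIn (N ω) (fun i => X i ω) (B j)) ω ∂Pr =
      ENNReal.ofReal (Real.exp (lam * (volume.real (B j ∩ 𝒜)) * ((e.symm j : ℝ) - 1))) := by
    intro j
    have := lintegral_map (f := fun k : ℕ => ENNReal.ofReal ((e.symm j : ℝ) ^ k)) (μ := Pr)
      (measurable_of_countable _) (measurable_countIn h (hB j))
    simp only [Function.comp_apply]
    rw [← this, h.count_law _ (hB j), lhasSum_pow_poisson _ (hr0 _ (e.symm j).2),
      Real.coe_toNNReal _ (by positivity)]
  rw [Finset.prod_congr rfl (fun j _ => hone j),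
    ← ENNReal.ofReal_prod_of_nonneg (fun _ _ => (Real.exp_pos _).le),
    ENNReal.toReal_ofReal (Finset.prod_nonneg fun _ _ => (Real.exp_pos _).le), ← Real.exp_sum]
  congr 1
  have hs : ∫ x in 𝒜, (w x - 1) = ∑ v ∈ w.range, volume.real (w ⁻¹' {v} ∩ 𝒜) * (v - 1) := by
    have h1 : ∑ v ∈ w.range, (volume.restrict 𝒜).real (w ⁻¹' {v}) =
        (volume.restrict 𝒜).real Set.univ := by
      rw [sum_measureReal_preimage_singleton _ fun v _ => w.measurableSet_preimage _]
      congr 1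
      ext x
      simp
    rw [integral_sub hint (integrable_const _), ← SimpleFunc.integral_eq_integral _ hint,
      SimpleFunc.integral_eq, integral_const, ← h1, smul_eq_mul, mul_one,
      ← Finset.sum_sub_distrib]
    refine Finset.sum_congr rfl fun v _ => ?_
    rw [measureReal_restrict_apply (w.measurableSet_preimage _), smul_eq_mul]
    ring
  rw [hs, Finset.mul_sum, ← Finset.sum_coe_sort w.range, ← e.symm.sum_comp]
  exact Finset.sum_congr rfl fun j _ => mul_assoc _ _ _

/-- The probability generating functional of a homogeneous Poisson point process. -/
theorem integral_prod_position (h : IsHomogeneousPPP Pr lam 𝒜 N X) (hlam : 0 ≤ lam)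
    (h𝒜fin : volume 𝒜 ≠ ⊤) {w : Plane → ℝ} (hw : Measurable w) {M : ℝ}
    (hw0 : ∀ x, w x ∈ Set.Icc 0 M) :
    ∫ ω, ∏ i ∈ Finset.range (N ω), w (X i ω) ∂Pr = Real.exp (lam * ∫ x in 𝒜, (w x - 1)) := by
  have : IsFiniteMeasure (volume.restrict 𝒜) := ⟨by simpa using h𝒜fin.lt_top⟩
  have hM : 0 ≤ M := (hw0 0).1.trans (hw0 0).2
  -- Approximants with values in `[0, M]` keep the products below `M ^ N` and the integrands within
  -- `M + 1`, so dominated convergence applies on both sides.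
  set f : ℕ → SimpleFunc Plane ℝ := SimpleFunc.approxOn w hw (Set.Icc 0 M) 0 ⟨le_rfl, hM⟩
  have hf : ∀ k x, f k x ∈ Set.Icc 0 M := fun k x => SimpleFunc.approxOn_mem hw _ k x
  have hlim : ∀ x, Tendsto (fun k => f k x) atTop (𝓝 (w x)) := fun x =>
    SimpleFunc.tendsto_approxOn hw _ (subset_closure (hw0 x))
  have h1 : Tendsto (fun k => ∫ ω, ∏ i ∈ Finset.range (N ω), f k (X i ω) ∂Pr) atTop
      (𝓝 (∫ ω, ∏ i ∈ Finset.range (N ω), w (X i ω) ∂Pr)) := by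
    refine tendsto_integral_of_dominated_convergence (fun ω => M ^ N ω)
      (fun k => (measurable_prod_position h (f k).measurable).aestronglyMeasurable)
      (integrable_pow_number h hM) (fun k => ae_of_all _ fun ω => ?_)
      (ae_of_all _ fun ω => tendsto_finsetProd _ fun i _ => hlim _)
    rw [Real.norm_of_nonneg (Finset.prod_nonneg fun i _ => (hf k _).1)]
    exact prod_range_le_pow (N ω) fun i => hf k (X i ω)
  have h2 : Tendsto (fun k => Real.exp (lam * ∫ x in 𝒜, (f k x - 1))) atTop
      (𝓝 (Real.exp (lam * ∫ x in 𝒜, (w x - 1)))) := by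
    refine (Real.continuous_exp.tendsto _).comp (Tendsto.const_mul _ ?_)
    refine tendsto_integral_of_dominated_convergence (fun _ => M + 1)
      (fun k => ((f k).measurable.sub_const 1).aestronglyMeasurable) (integrable_const _)
      (fun k => ae_of_all _ fun x => ?_) (ae_of_all _ fun x => (hlim x).sub_const 1)
    have := hf k x
    rw [Real.norm_eq_abs, abs_le]
    constructor <;> linarith [this.1, this.2]
  refine tendsto_nhds_unique h1 (h2.congr fun k => ?_)
  exact (integral_prod_simpleFunc h hlam h𝒜fin (f k) fun x => (hf k x).1).symm

lemma measurable_sum_position_prod_erase (h : IsHomogeneousPPP Pr lam 𝒜 N X) {b w : Plane → ℝ}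
    (hb : Measurable b) (hw : Measurable w) :
    Measurable (fun ω => ∑ i ∈ Finset.range (N ω),
      b (X i ω) * ∏ j ∈ (Finset.range (N ω)).erase i, w (X j ω)) := by
  refine measurable_of_measurable_fixed_count h.measurable_number
    (f := fun k ω => ∑ i ∈ Finset.range k,
      b (X i ω) * ∏ j ∈ (Finset.range k).erase i, w (X j ω)) fun k => ?_
  exact Finset.measurable_fun_sum _ fun i _ => (hb.comp (h.measurable_position i)).mul
    (Finset.measurable_fun_prod _ fun j _ => hw.comp (h.measurable_position j))

lemma abs_sum_indicator_mul_prod_erase_le (n : ℕ) (x : ℕ → Plane) (B : Set Plane)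
    {w : Plane → ℝ} (hw : ∀ x, |w x| ≤ 2) :
    |∑ i ∈ Finset.range n, B.indicator 1 (x i) * ∏ j ∈ (Finset.range n).erase i, w (x j)| ≤
      (4 : ℝ) ^ n := by
  have h1 : ∀ i ∈ Finset.range n,
      |B.indicator 1 (x i) * ∏ j ∈ (Finset.range n).erase i, w (x j)| ≤ (2 : ℝ) ^ n := by
    intro i hi
    rw [abs_mul, Finset.abs_prod]
    have hb : |B.indicator (1 : Plane → ℝ) (x i)| ≤ 1 := by
      by_cases hx : x i ∈ B <;> simp [hx]
    have hp : ∏ j ∈ (Finset.range n).erase i, |w (x j)| ≤ 2 ^ n := by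
      calc ∏ j ∈ (Finset.range n).erase i, |w (x j)|
          ≤ ∏ j ∈ (Finset.range n).erase i, (2 : ℝ) :=
            Finset.prod_le_prod (fun _ _ => abs_nonneg _) fun j _ => hw _
        _ ≤ 2 ^ n := by
            rw [Finset.prod_const]
            exact pow_le_pow_right₀ (by norm_num)
              ((Finset.card_le_card (Finset.erase_subset _ _)).trans (by simp))
    exact (mul_le_mul hb hp (Finset.prod_nonneg fun _ _ => abs_nonneg _) zero_le_one).trans
      (by simp)
  calc _ ≤ ∑ i ∈ Finset.range n, (2 : ℝ) ^ n :=
        (Finset.abs_sum_le_sum_abs _ _).trans (Finset.sum_le_sum h1)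
    _ = n * 2 ^ n := by simp
    _ ≤ 2 ^ n * 2 ^ n := by
        gcongr
        exact_mod_cast (Nat.lt_two_pow_self (n := n)).le
    _ = 4 ^ n := by rw [← mul_pow]; norm_num

/-- The reduced Campbell (Mecke) formula for product functionals. -/
theorem integral_sum_prod_erase (h : IsHomogeneousPPP Pr lam 𝒜 N X) (hlam : 0 ≤ lam)
    (h𝒜fin : volume 𝒜 ≠ ⊤) {v : Plane → ℝ} (hv : Measurable v)
    (hv01 : ∀ x, v x ∈ Set.Icc 0 1) {B : Set Plane} (hB : MeasurableSet B) :
    ∫ ω, ∑ i ∈ Finset.range (N ω),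
        B.indicator 1 (X i ω) * ∏ j ∈ (Finset.range (N ω)).erase i, v (X j ω) ∂Pr =
      lam * volume.real (B ∩ 𝒜) * Real.exp (lam * ∫ x in 𝒜, (v x - 1)) := by
  have : IsFiniteMeasure (volume.restrict 𝒜) := ⟨by simpa using h𝒜fin.lt_top⟩
  -- Perturbing `v` along the indicator of `B`: by the product rule, the derivative at `ε = 0` of
  -- the product over the points is the sum on the left-hand side.
  set w : ℝ → Plane → ℝ := fun ε x => v x + ε * B.indicator 1 x
  have hbm : Measurable (B.indicator (1 : Plane → ℝ)) := measurable_one.indicator hB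
  have hb01 : ∀ x, B.indicator (1 : Plane → ℝ) x ∈ Set.Icc 0 1 := by
    intro x
    by_cases hx : x ∈ B <;> simp [hx]
  have hw : ∀ ε, Measurable (w ε) := fun ε => hv.add (hbm.const_mul ε)
  have hwabs : ∀ ε ∈ Metric.ball (0 : ℝ) 1, ∀ x, |w ε x| ≤ 2 := by
    intro ε hε x
    have h1 := hv01 x
    have h2 := hb01 x
    have h3 : |ε * B.indicator 1 x| ≤ 1 := by
      rw [abs_mul, abs_of_nonneg h2.1]
      rw [mem_ball_zero_iff, Real.norm_eq_abs] at hε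
      nlinarith [abs_nonneg ε, h2.1, h2.2]
    calc |w ε x| ≤ |v x| + |ε * B.indicator 1 x| := abs_add_le _ _
      _ ≤ 2 := by rw [abs_of_nonneg h1.1]; linarith [h1.2]
  have hd := (hasDerivAt_integral_of_dominated_loc_of_deriv_le (μ := Pr) (x₀ := (0 : ℝ))
    (F := fun ε ω => ∏ i ∈ Finset.range (N ω), w ε (X i ω))
    (F' := fun ε ω => ∑ i ∈ Finset.range (N ω),
        B.indicator 1 (X i ω) * ∏ j ∈ (Finset.range (N ω)).erase i, w ε (X j ω))
    (bound := fun ω => 4 ^ N ω) (Metric.ball_mem_nhds 0 one_pos)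
    (Eventually.of_forall fun ε => (measurable_prod_position h (hw ε)).aestronglyMeasurable)
    ?_ (measurable_sum_position_prod_erase h hbm (hw 0)).aestronglyMeasurable
    (ae_of_all _ fun ω ε hε => abs_sum_indicator_mul_prod_erase_le _ _ _ (hwabs ε hε))
    (integrable_pow_number h (by norm_num)) (ae_of_all _ fun ω ε _ => ?_)).2
  rotate_left
  · refine (integrable_pow_number h zero_le_two).mono'
      (measurable_prod_position h (hw 0)).aestronglyMeasurable (ae_of_all _ fun ω => ?_)
    rw [Real.norm_eq_abs, Finset.abs_prod]
    exact prod_range_le_pow (N ω) fun i => ⟨abs_nonneg _, hwabs 0 (by simp) (X i ω)⟩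
  · have := HasDerivAt.fun_finsetProd (u := Finset.range (N ω))
      (f := fun i ε => w ε (X i ω)) (f' := fun i => B.indicator 1 (X i ω)) (x := ε)
      (fun i _ => by
        change HasDerivAt (fun ε => v (X i ω) + ε * B.indicator 1 (X i ω)) _ ε
        simpa using ((hasDerivAt_id ε).mul_const (B.indicator (1 : Plane → ℝ) (X i ω))).const_add
          (v (X i ω)))
    simpa [mul_comm] using this
  have hvint : Integrable v (volume.restrict 𝒜) :=
    (integrable_const (1 : ℝ)).mono' hv.aestronglyMeasurable (ae_of_all _ fun x => by
      rw [Real.norm_of_nonneg (hv01 x).1]; exact (hv01 x).2)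
  have hbint : Integrable (B.indicator (1 : Plane → ℝ)) (volume.restrict 𝒜) :=
    (integrable_const (1 : ℝ)).indicator hB
  -- The generating functional is available for nonnegative functions only, and `v` may vanish on
  -- `B`. The formula thus holds for `ε ≥ 0`, and the derivatives are compared within `[0, ∞)`.
  have hexp : ∀ ε ∈ Set.Ici (0 : ℝ), ∫ ω, ∏ i ∈ Finset.range (N ω), w ε (X i ω) ∂Pr =
      Real.exp (lam * ((∫ x in 𝒜, (v x - 1)) + ε * volume.real (B ∩ 𝒜))) := by
    intro ε hε
    rw [integral_prod_position h hlam h𝒜fin (hw ε) (M := 1 + ε) fun x =>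
      ⟨add_nonneg (hv01 x).1 (mul_nonneg hε (hb01 x).1),
        add_le_add (hv01 x).2 (mul_le_of_le_one_right hε (hb01 x).2)⟩]
    congr 2
    have : ∀ x, w ε x - 1 = (v x - 1) + ε * B.indicator 1 x := fun x => by simp only [w]; ring
    simp_rw [this]
    rw [integral_add (f := fun x => v x - 1) (hvint.sub (integrable_const _)) (hbint.const_mul ε), integral_const_mul,
      integral_indicator_one hB, measureReal_restrict_apply hB]
  have hd2 : HasDerivAt
      (fun ε => Real.exp (lam * ((∫ x in 𝒜, (v x - 1)) + ε * volume.real (B ∩ 𝒜))))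
      (Real.exp (lam * ((∫ x in 𝒜, (v x - 1)) + 0 * volume.real (B ∩ 𝒜))) *
        (lam * (1 * volume.real (B ∩ 𝒜)))) (0 : ℝ) :=
    ((((hasDerivAt_id (0 : ℝ)).mul_const _).const_add _).const_mul lam).exp
  have huniq := (uniqueDiffWithinAt_Ici (0 : ℝ)).eq_deriv _
    (hd.hasDerivWithinAt (s := Set.Ici 0))
    ((hd2.hasDerivWithinAt (s := Set.Ici 0)).congr hexp (hexp 0 Set.self_mem_Ici))
  simp only [w, zero_mul, add_zero] at huniq
  rw [huniq]
  ring

end PoissonProcess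

/-! ### Laplace transform and tail of the Gamma law with integer shape -/

section Gamma

/-- Exponential tilting turns the density of rate `m` into a multiple of the density of rate `m +
t`, which has total mass one. -/
lemma lintegral_exp_neg_mul_gammaMeasure {m : ℕ} (hm : 1 ≤ m) {t : ℝ} (ht : 0 ≤ t) :
    ∫⁻ g, ENNReal.ofReal (Real.exp (-t * g)) ∂(gammaMeasure m m) =
      ENNReal.ofReal ((1 + t / m) ^ (-(m : ℤ))) := by
  have hm0 : (0 : ℝ) < m := by exact_mod_cast hm
  have hpdf : ∀ g, gammaPDF m m g * ENNReal.ofReal (Real.exp (-t * g)) =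
      ENNReal.ofReal ((1 + t / m) ^ (-(m : ℤ))) * gammaPDF m (m + t) g := by
    intro g
    have h1 : 0 ≤ (1 + t / m) ^ (-(m : ℤ)) := by positivity
    have h2 : (1 + t / m : ℝ) = (m + t) / m := by field_simp
    rw [gammaPDF, gammaPDF, ← ENNReal.ofReal_mul (gammaPDFReal_nonneg hm0 hm0 g),
      ← ENNReal.ofReal_mul h1]
    congr 1
    unfold gammaPDFReal
    split_ifs
    · have h3 : Real.exp (-((m + t) * g)) = Real.exp (-(m * g)) * Real.exp (-t * g) := by
        rw [← Real.exp_add]; congr 1; ring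
      rw [h3, h2, zpow_neg, zpow_natCast, Real.rpow_natCast, Real.rpow_natCast, div_pow]
      have : (0 : ℝ) < m + t := by positivity
      field_simp
    · simp
  have hmeas : ∀ r, Measurable (gammaPDF m r) := fun r =>
    (measurable_gammaPDFReal _ _).ennreal_ofReal
  rw [gammaMeasure, lintegral_withDensity_eq_lintegral_mul _ (hmeas m) (by fun_prop)]
  simp only [Pi.mul_apply, hpdf]
  rw [lintegral_const_mul _ (hmeas _), lintegral_gammaPDF_eq_one hm0 (by positivity), mul_one]

lemma gammaMeasure_Iio_zero (a r : ℝ) : gammaMeasure a r (Set.Iio 0) = 0 := by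
  rw [gammaMeasure, withDensity_apply _ measurableSet_Iio, lintegral_gammaPDF_of_nonpos le_rfl]

/-- The tail function of the Gamma law of shape `m` and rate `m`. -/
def gammaTail (m : ℕ) (t : ℝ) : ℝ :=
  ∑ k ∈ Finset.range m, (m * t) ^ k / (k.factorial : ℝ) * Real.exp (-(m * t))

lemma measurable_gammaTail (m : ℕ) : Measurable (gammaTail m) := by
  unfold gammaTail
  fun_prop

lemma gammaTail_nonneg (m : ℕ) {t : ℝ} (ht : 0 ≤ t) : 0 ≤ gammaTail m t :=
  Finset.sum_nonneg fun k _ => by positivity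

lemma hasDerivAt_sum_pow_div_factorial_mul_exp (n : ℕ) (x : ℝ) :
    HasDerivAt (fun x => ∑ k ∈ Finset.range (n + 1), x ^ k / (k.factorial : ℝ) * Real.exp (-x))
      (-(x ^ n / (n.factorial : ℝ) * Real.exp (-x))) x := by
  have he : HasDerivAt (fun x : ℝ => Real.exp (-x)) (-Real.exp (-x)) x := by
    simpa using (hasDerivAt_neg x).exp
  induction n with
  | zero => simpa using he
  | succ n ih =>
    simp_rw [Finset.sum_range_succ _ (n + 1)]
    have h1 := ((hasDerivAt_pow (n + 1) x).div_const ((n + 1).factorial : ℝ)).mul he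
    refine (ih.add h1).congr_deriv ?_
    have : ((n + 1).factorial : ℝ) = (n + 1) * n.factorial := by
      rw [Nat.factorial_succ]; push_cast; ring
    rw [this]
    have hn : (n.factorial : ℝ) ≠ 0 := by positivity
    have hn1 : (n + 1 : ℝ) ≠ 0 := by positivity
    push_cast
    field_simp
    ring

/-- The derivative of `gammaTail` telescopes to minus the density, and `gammaTail` vanishes at
infinity. -/
lemma gammaMeasure_Ici {m : ℕ} (hm : 1 ≤ m) {t : ℝ} (ht : 0 ≤ t) :
    gammaMeasure m m (Set.Ici t) = ENNReal.ofReal (gammaTail m t) := by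
  obtain ⟨n, rfl⟩ : ∃ n, m = n + 1 := ⟨m - 1, by omega⟩
  set r : ℝ := ((n + 1 : ℕ) : ℝ) with hr
  have hr0 : 0 < r := by positivity
  have hderiv : ∀ x ∈ Set.Ici t, HasDerivAt (fun x => gammaTail (n + 1) x)
      (-gammaPDFReal r r x) x := by
    intro x hx
    have hx0 : 0 ≤ x := ht.trans hx
    have h1 := (hasDerivAt_sum_pow_div_factorial_mul_exp n (r * x)).comp x
      ((hasDerivAt_id x).const_mul r)
    refine h1.congr_deriv ?_
    have hG : Real.Gamma r = n.factorial := by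
      rw [hr]; push_cast; exact Real.Gamma_nat_eq_factorial n
    rw [gammaPDFReal, if_pos hx0, hG, hr, Real.rpow_natCast]
    have : (((n + 1 : ℕ) : ℝ) - 1) = (n : ℝ) := by push_cast; ring
    rw [this, Real.rpow_natCast, pow_succ, mul_pow]
    ring
  have hlim : Tendsto (fun x => gammaTail (n + 1) x) atTop (𝓝 0) := by
    have hk : ∀ k ∈ Finset.range (n + 1),
        Tendsto (fun x : ℝ => (r * x) ^ k / (k.factorial : ℝ) * Real.exp (-(r * x))) atTop
          (𝓝 0) := by
      intro k _
      have h1 := ((Real.tendsto_pow_mul_exp_neg_atTop_nhds_zero k).comp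
        (tendsto_id.const_mul_atTop hr0)).const_mul (k.factorial : ℝ)⁻¹
      rw [mul_zero] at h1
      refine h1.congr fun x => ?_
      simp only [Function.comp_apply, id]
      ring
    have hsum := tendsto_finsetSum _ hk
    rw [Finset.sum_const_zero] at hsum
    exact hsum
  have hneg : ∀ x ∈ Set.Ioi t, -gammaPDFReal r r x ≤ 0 := fun x _ =>
    neg_nonpos.2 (gammaPDFReal_nonneg hr0 hr0 x)
  have hint := integrableOn_Ioi_deriv_of_nonpos' hderiv hneg hlim
  have hval := integral_Ioi_of_hasDerivAt_of_nonpos' hderiv hneg hlim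
  rw [integral_neg, zero_sub, neg_inj] at hval
  have hint' : IntegrableOn (gammaPDFReal r r) (Set.Ioi t) := by
    simpa using hint.neg
  rw [gammaMeasure, withDensity_apply _ measurableSet_Ici, setLIntegral_congr Ioi_ae_eq_Ici.symm,
    ← hval, ofReal_integral_eq_lintegral_ofReal hint'
      (ae_of_all _ fun x => gammaPDFReal_nonneg hr0 hr0 x)]
  rfl

end Gamma

/-! ### Separating one node's gain from the rest of the slot -/

section Independence

variable {Ω : Type*} [MeasurableSpace Ω] {Pr : Measure Ω}

lemma _root_.ProbabilityTheory.IndepFun.prodMk_right_of_prodMk_left [IsProbabilityMeasure Pr] {α β γ : Type*}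
    [MeasurableSpace α] [MeasurableSpace β] [MeasurableSpace γ]
    {A : Ω → α} {B : Ω → β} {C : Ω → γ} (hA : Measurable A) (hB : Measurable B)
    (hC : Measurable C) (hAB : IndepFun A B Pr) (hABC : IndepFun (fun ω => (A ω, B ω)) C Pr) :
    IndepFun A (fun ω => (B ω, C ω)) Pr := by
  have hBC : IndepFun B C Pr := hABC.comp measurable_snd measurable_id
  have := Measure.isProbabilityMeasure_map (μ := Pr) hA.aemeasurable
  have := Measure.isProbabilityMeasure_map (μ := Pr) hB.aemeasurable
  have := Measure.isProbabilityMeasure_map (μ := Pr) hC.aemeasurable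
  rw [indepFun_iff_map_prod_eq_prod_map_map (by fun_prop) (by fun_prop)] at hAB hABC hBC ⊢
  rw [hBC, ← Measure.prodAssoc_prod, ← hAB, ← hABC,
    Measure.map_map (by fun_prop) (by fun_prop)]
  rfl

/-- Overwriting coordinate `i` by a constant gives a sequence measurable with respect to the other
coordinates, while the index type stays `ℕ`. -/
lemma _root_.ProbabilityTheory.iIndepFun.indepFun_update {α : Type*} [MeasurableSpace α]
    {f : ℕ → Ω → α} (hf : iIndepFun f Pr) (hm : ∀ i, Measurable (f i)) (i : ℕ) (a : α) :
    IndepFun (f i) (fun ω => Function.update (fun j => f j ω) i a) Pr := by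
  rw [IndepFun_iff_Indep]
  have h := indep_iSup_of_disjoint (fun j => (hm j).comap_le) hf
    (S := {i}) (T := {i}ᶜ) disjoint_compl_right
  refine indep_of_indep_of_le_right (indep_of_indep_of_le_left h ?_) ?_
  · exact le_iSup₂_of_le i rfl le_rfl
  · rw [← measurable_iff_comap_le]
    refine @measurable_pi_lambda _ _ _ (_) _ _ fun j => ?_
    by_cases hj : j = i
    · subst hj
      simp only [Function.update_self]
      exact measurable_const
    · simp only [Function.update_of_ne hj]
      rw [measurable_iff_comap_le]
      exact le_iSup₂_of_le (f := fun j (_ : j ∈ ({i}ᶜ : Set ℕ)) =>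
        MeasurableSpace.comap (f j) inferInstance) j hj le_rfl

variable {lam a : ℝ} {m : ℕ} {𝒜 : Set Plane}
  {N : Ω → ℕ} {X : ℕ → Ω → Plane} {T : ℕ → Ω → Bool} {G : ℕ → Ω → ℝ}

/-- The gain of a node is independent of its transmission decision, the marks of the other nodes
and the node positions. -/
lemma IsSlot.indepFun_gain [IsProbabilityMeasure Pr] (hs : IsSlot Pr lam a m 𝒜 N X T G) (i : ℕ) :
    IndepFun (G i) (fun ω => ((T i ω,
      Function.update (fun j => (T j ω, G j ω)) i (false, 0)), (N ω, fun j => X j ω))) Pr := by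
  have hτ : ∀ j, Measurable (fun ω => (T j ω, G j ω)) := fun j =>
    (hs.measurable_decision j).prodMk (hs.measurable_gain j)
  have hτ' : Measurable (fun ω j => (T j ω, G j ω)) := measurable_pi_lambda _ hτ
  have hupd : Measurable (fun τ : ℕ → Bool × ℝ => Function.update τ i (false, 0)) := by
    refine measurable_pi_lambda _ fun j => ?_
    by_cases hj : j = i
    · subst hj; simp
    · simpa [Function.update_of_ne hj] using measurable_pi_apply j
  have hX : Measurable (fun ω => (N ω, fun j => X j ω)) :=
    hs.nodes.measurable_number.prodMk (measurable_pi_lambda _ hs.nodes.measurable_position)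
  have h1 := hs.marks_indep.indepFun_update hτ i (false, 0)
  have h2 := (hs.decision_indep_gain i).symm.prodMk_right_of_prodMk_left
    (hs.measurable_gain i) (hs.measurable_decision i) (hupd.comp hτ')
    (h1.comp measurable_swap measurable_id)
  refine h2.prodMk_right_of_prodMk_left (hs.measurable_gain i)
    ((hs.measurable_decision i).prodMk (hupd.comp hτ')) hX ?_
  exact (hs.marks_indep_nodes.symm.comp
    (φ := fun τ : ℕ → Bool × ℝ => ((τ i).2, ((τ i).1, Function.update τ i (false, 0))))
    (by fun_prop) measurable_id)

end Independence

/-! ### Interference as a function of the other nodes' marks -/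

section Interference

/-- The interference plus noise, normalized by the transmission power, of a whole configuration
`(n, x, τ)` of nodes and marks. -/
def totalInterference (Pt η σ2 : ℝ) (c : Plane) (h R : ℝ)
    (p : ℕ × (ℕ → Plane) × (ℕ → Bool × ℝ)) : ℝ :=
  ∑ j ∈ active c R p.1 p.2.1 (fun j => (p.2.2 j).1),
    (p.2.2 j).2 * droneDist c h (p.2.1 j) ^ (-η) + σ2 / Pt

lemma measurable_droneDist (c : Plane) (h : ℝ) : Measurable (droneDist c h) := by
  unfold droneDist
  fun_prop

lemma measurable_totalInterference (Pt η σ2 : ℝ) (c : Plane) (h R : ℝ) :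
    Measurable (totalInterference Pt η σ2 c h R) := by
  classical
  refine measurable_from_prod_countable_right fun n => ?_
  simp only [totalInterference, active, Finset.sum_filter]
  refine Measurable.add_const (Finset.measurable_fun_sum _ fun j _ => ?_) _
  refine Measurable.ite ?_ ?_ measurable_const
  · refine MeasurableSet.inter ?_ ?_
    · exact (measurable_pi_apply j).comp measurable_fst Metric.isClosed_closedBall.measurableSet
    · exact (measurable_fst.comp ((measurable_pi_apply j).comp measurable_snd))
        (measurableSet_singleton true)
  · have h1 := measurable_droneDist c h
    fun_prop

lemma active_update (c : Plane) (R : ℝ) (n : ℕ) (x : ℕ → Plane) (τ : ℕ → Bool × ℝ) (i : ℕ) :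
    active c R n x (fun j => (Function.update τ i (false, 0) j).1) =
      (active c R n x (fun j => (τ j).1)).erase i := by
  classical
  ext j
  by_cases hj : j = i
  · subst hj; simp [active]
  · simp [active, hj]

/-- The mark `(false, 0)` deactivates node `i`. The right-hand side thus involves neither its
decision nor its gain, as the independence argument requires. -/
lemma interference_eq_totalInterference (Pt η σ2 : ℝ) (c : Plane) (h R : ℝ) (n : ℕ)
    (x : ℕ → Plane) (τ : ℕ → Bool × ℝ) (i : ℕ) :
    interference Pt η σ2 c h (active c R n x (fun j => (τ j).1)) x (fun j => (τ j).2) i =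
      totalInterference Pt η σ2 c h R (n, x, Function.update τ i (false, 0)) := by
  unfold interference totalInterference
  simp only [active_update]
  congr 1
  refine Finset.sum_congr rfl fun j hj => ?_
  rw [Function.update_of_ne (Finset.ne_of_mem_erase hj)]

end Interference

/-! ### Integration over the lens in polar coordinates -/

section Polar

/-- Cosine is even and decreasing in `|φ|`, so the set is `|φ| ≤ arccos K` up to endpoints. The
truncation of `Real.arccos` outside `[-1, 1]` covers the remaining `K`. -/
lemma volume_setOf_le_cos (K : ℝ) :
    volume {φ ∈ Set.Ioo (-Real.pi) Real.pi | K ≤ Real.cos φ} =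
      ENNReal.ofReal (2 * Real.arccos K) := by
  rcases lt_or_ge 1 K with hK | hK
  · have : {φ ∈ Set.Ioo (-Real.pi) Real.pi | K ≤ Real.cos φ} = ∅ := by
      ext φ
      simp only [Set.mem_ofPred_eq, Set.mem_empty_iff_false, iff_false, not_and, not_le]
      exact fun _ => (Real.cos_le_one φ).trans_lt hK
    rw [this, Real.arccos_of_one_le hK.le]
    simp
  · have hα := Real.arccos_le_pi K
    have hiff : ∀ φ ∈ Set.Ioo (-Real.pi) Real.pi, (K ≤ Real.cos φ ↔ |φ| ≤ Real.arccos K) := by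
      intro φ hφ
      have habs : |φ| ≤ Real.pi := (abs_lt.2 hφ).le
      rcases lt_or_ge K (-1) with hK1 | hK1
      · rw [Real.arccos_of_le_neg_one hK1.le]
        exact iff_of_true (hK1.le.trans (Real.neg_one_le_cos φ)) habs
      · rw [← Real.cos_abs φ]
        conv_lhs => rw [← Real.cos_arccos hK1 hK]
        exact Real.strictAntiOn_cos.le_iff_ge ⟨Real.arccos_nonneg _, hα⟩ ⟨abs_nonneg _, habs⟩
    refine le_antisymm ?_ ?_
    · calc _ ≤ volume (Set.Icc (-Real.arccos K) (Real.arccos K)) :=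
            measure_mono fun φ hφ => abs_le.1 ((hiff φ hφ.1).1 hφ.2)
        _ = _ := by rw [Real.volume_Icc]; congr 1; ring
    · calc _ = volume (Set.Ioo (-Real.arccos K) (Real.arccos K)) := by
            rw [Real.volume_Ioo]; congr 1; ring
        _ ≤ _ := measure_mono fun φ hφ => by
            have hφ' : φ ∈ Set.Ioo (-Real.pi) Real.pi := ⟨by linarith [hφ.1], by linarith [hφ.2]⟩
            exact ⟨hφ', (hiff φ hφ').2 (abs_lt.2 hφ).le⟩

/-- In the first case of `theta` the quotient is at most `-1`, in the last at least `1`; there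
`Real.arccos` is `π` and `0`, so one formula covers all three. -/
lemma theta_eq_arccos {R Rmse w : ℝ} (hR : 0 < R) (hRmse : 0 < Rmse) (hw : 0 < w) (hwR : w ≤ R) :
    theta R Rmse w = 2 * Real.arccos ((R ^ 2 + w ^ 2 - Rmse ^ 2) / (2 * R * w)) := by
  have h2 : 0 < 2 * R * w := by positivity
  unfold theta
  split_ifs with h1 h3
  · have hle : w ≤ Rmse - R := by
      rcases le_max_iff.1 h1.2 with h | h
      · linarith
      · exact h
    rw [Real.arccos_of_le_neg_one]
    rw [div_le_iff₀ h2]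
    nlinarith
  · rfl
  · have hlt : w < |Rmse - R| := by
      by_contra hcon
      exact h3 ⟨not_lt.1 hcon, by linarith⟩
    have hgt : Rmse - R < w := by
      by_contra hcon
      exact h1 ⟨hw.le, le_max_of_le_right (not_lt.1 hcon)⟩
    have : w < R - Rmse := by
      rcases abs_cases (Rmse - R) with ⟨h, _⟩ | ⟨h, _⟩ <;> linarith
    rw [Real.arccos_of_one_le, mul_zero]
    rw [le_div_iff₀ h2]
    nlinarith

lemma exists_linearIsometryEquiv_complex (v : Plane) :
    ∃ U : Plane ≃ₗᵢ[ℝ] ℂ, U v = (‖v‖ : ℂ) := by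
  set U₀ : Plane ≃ₗᵢ[ℝ] ℂ := Complex.orthonormalBasisOneI.repr.symm
  refine ⟨U₀.trans (rotation (Circle.exp (-(U₀ v).arg))), ?_⟩
  have h1 := Complex.norm_mul_exp_arg_mul_I (U₀ v)
  rw [U₀.norm_map v] at h1
  rw [LinearIsometryEquiv.trans_apply, rotation_apply, Circle.coe_exp]
  calc Complex.exp (((-(U₀ v).arg : ℝ) : ℂ) * Complex.I) * U₀ v
      = Complex.exp (((-(U₀ v).arg : ℝ) : ℂ) * Complex.I) *
          (‖v‖ * Complex.exp ((U₀ v).arg * Complex.I)) := by rw [h1]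
    _ = ‖v‖ := by
      rw [mul_left_comm, ← Complex.exp_add]
      push_cast
      rw [neg_mul, neg_add_cancel, Complex.exp_zero, mul_one]

lemma norm_polar_sub_sq (w φ R : ℝ) :
    ‖Complex.polarCoord.symm (w, φ) - R‖ ^ 2 = w ^ 2 + R ^ 2 - 2 * R * w * Real.cos φ := by
  rw [Complex.polarCoord_symm_apply, ← Complex.normSq_eq_norm_sq, Complex.normSq_apply]
  simp only [Complex.sub_re, Complex.sub_im,
    Complex.mul_re, Complex.mul_im, Complex.add_re, Complex.add_im, Complex.ofReal_re,
    Complex.ofReal_im, Complex.I_re, Complex.I_im]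
  linear_combination w ^ 2 * Real.sin_sq_add_cos_sq φ

lemma norm_polar_sub_le_iff {w φ R ρ : ℝ} (hw : 0 < w) (hR : 0 < R) (hρ : 0 < ρ) :
    ‖Complex.polarCoord.symm (w, φ) - R‖ ≤ ρ ↔
      (R ^ 2 + w ^ 2 - ρ ^ 2) / (2 * R * w) ≤ Real.cos φ := by
  rw [div_le_iff₀ (by positivity), ← sq_le_sq₀ (norm_nonneg _) hρ.le, norm_polar_sub_sq]
  constructor <;> intro h <;> linarith

/-- By the law of cosines, the angles admitted at radius `w ≤ R` are given by a lower bound on `cos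
φ`; their measure is `theta R ρ w`. -/
lemma lintegral_lens_complex {R ρ : ℝ} (hR : 0 < R) (hρ : 0 < ρ) {F : ℝ → ENNReal}
    (hF : Measurable F) :
    ∫⁻ z in {z : ℂ | ‖z - R‖ ≤ ρ ∧ ‖z‖ ≤ R}, F ‖z‖ =
      ∫⁻ w in Set.Ioo 0 R, ENNReal.ofReal w * (F w * ENNReal.ofReal (theta R ρ w)) := by
  have hS : MeasurableSet {z : ℂ | ‖z - R‖ ≤ ρ ∧ ‖z‖ ≤ R} :=
    (measurableSet_le (f := fun z : ℂ => ‖z - R‖) (by fun_prop) measurable_const).inter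
      (measurableSet_le measurable_norm measurable_const)
  have hΦ : Measurable ({z : ℂ | ‖z - R‖ ≤ ρ ∧ ‖z‖ ≤ R}.indicator fun z => F ‖z‖) :=
    (hF.comp measurable_norm).indicator hS
  have hsymm : Measurable (Complex.polarCoord.symm : ℝ × ℝ → ℂ) := by
    have : (Complex.polarCoord.symm : ℝ × ℝ → ℂ) =
        fun p => p.1 * (Real.cos p.2 + Real.sin p.2 * Complex.I) := by
      ext p; exact Complex.polarCoord_symm_apply p
    rw [this]
    fun_prop
  rw [← lintegral_indicator hS, ← Complex.lintegral_comp_polarCoord_symm, polarCoord_target,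
    Measure.volume_eq_prod, ← Measure.prod_restrict,
    lintegral_prod _ (by
      exact ((measurable_fst.ennreal_ofReal).mul (hΦ.comp hsymm)).aemeasurable)]
  have hinner : ∀ w ∈ Set.Ioi (0 : ℝ), ∫⁻ φ in Set.Ioo (-Real.pi) Real.pi,
      ENNReal.ofReal w • {z : ℂ | ‖z - R‖ ≤ ρ ∧ ‖z‖ ≤ R}.indicator (fun z => F ‖z‖)
        (Complex.polarCoord.symm (w, φ)) =
      (Set.Iic R).indicator
        (fun w => ENNReal.ofReal w * (F w * ENNReal.ofReal (theta R ρ w))) w := by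
    intro w hw
    have hw0 : 0 < w := hw
    have hnorm : ∀ φ, ‖Complex.polarCoord.symm (w, φ)‖ = w := fun φ => by
      rw [Complex.norm_polarCoord_symm, abs_of_pos hw0]
    by_cases hwR : w ≤ R
    · rw [Set.indicator_of_mem (show w ∈ Set.Iic R from hwR)]
      set K := (R ^ 2 + w ^ 2 - ρ ^ 2) / (2 * R * w) with hK
      have hA : MeasurableSet {φ : ℝ | K ≤ Real.cos φ} :=
        measurableSet_le measurable_const (by fun_prop)
      have : ∀ φ, ENNReal.ofReal w • {z : ℂ | ‖z - R‖ ≤ ρ ∧ ‖z‖ ≤ R}.indicator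
          (fun z => F ‖z‖) (Complex.polarCoord.symm (w, φ)) =
          {φ : ℝ | K ≤ Real.cos φ}.indicator (fun _ => ENNReal.ofReal w * F w) φ := by
        intro φ
        by_cases hφ : K ≤ Real.cos φ
        · rw [Set.indicator_of_mem, Set.indicator_of_mem (show φ ∈ {φ | K ≤ Real.cos φ} from hφ),
            hnorm, smul_eq_mul]
          exact ⟨(norm_polar_sub_le_iff hw0 hR hρ).2 hφ, (hnorm φ).le.trans hwR⟩
        · rw [Set.indicator_of_notMem, Set.indicator_of_notMem
            (show φ ∉ {φ | K ≤ Real.cos φ} from hφ), smul_zero]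
          exact fun h => hφ ((norm_polar_sub_le_iff hw0 hR hρ).1 h.1)
      simp_rw [this]
      rw [lintegral_indicator_const hA, Measure.restrict_apply hA,
        show {φ : ℝ | K ≤ Real.cos φ} ∩ Set.Ioo (-Real.pi) Real.pi =
          {φ ∈ Set.Ioo (-Real.pi) Real.pi | K ≤ Real.cos φ} from Set.inter_comm _ _,
        volume_setOf_le_cos, theta_eq_arccos hR hρ hw0 hwR, mul_assoc]
    · rw [Set.indicator_of_notMem (show w ∉ Set.Iic R from hwR)]
      refine (lintegral_congr fun φ => ?_).trans lintegral_zero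
      rw [Set.indicator_of_notMem, smul_zero]
      exact fun h => hwR ((hnorm φ).symm.le.trans h.2)
  rw [setLIntegral_congr_fun measurableSet_Ioi hinner, lintegral_indicator measurableSet_Iic,
    Measure.restrict_restrict measurableSet_Iic, Set.inter_comm, Set.Ioi_inter_Iic,
    setLIntegral_congr Ioo_ae_eq_Ioc.symm]

lemma image_sqrt_sq_add_sq {h R : ℝ} (hh : 0 < h) (hR : 0 < R) :
    (fun w => √(w ^ 2 + h ^ 2)) '' Set.Ioo 0 R = Set.Ioo h (√(h ^ 2 + R ^ 2)) := by
  ext r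
  constructor
  · rintro ⟨w, hw, rfl⟩
    refine ⟨Real.lt_sqrt_of_sq_lt (by nlinarith [hw.1]), Real.sqrt_lt_sqrt (by positivity) ?_⟩
    nlinarith [hw.1, hw.2]
  · rintro ⟨h1, h2⟩
    have hr : 0 < r := hh.trans h1
    have h3 : r ^ 2 < h ^ 2 + R ^ 2 := (Real.lt_sqrt hr.le).1 h2
    have h4 : 0 < r ^ 2 - h ^ 2 := by nlinarith
    refine ⟨√(r ^ 2 - h ^ 2), ⟨Real.sqrt_pos.2 h4, ?_⟩, ?_⟩
    · rw [Real.sqrt_lt' hR]; linarith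
    · simp only [Real.sq_sqrt h4.le, sub_add_cancel, Real.sqrt_sq hr.le]

/-- Substituting `r = √(w ^ 2 + h ^ 2)` gives `r dr = w dw`. -/
lemma lintegral_comp_sqrt_sq_add_sq {h R : ℝ} (hh : 0 < h) (hR : 0 < R) (F Θ : ℝ → ENNReal) :
    ∫⁻ w in Set.Ioo 0 R, ENNReal.ofReal w * (F (√(w ^ 2 + h ^ 2)) * Θ w) =
      ∫⁻ r in Set.Ioo h (√(h ^ 2 + R ^ 2)), ENNReal.ofReal r * (F r * Θ (√(r ^ 2 - h ^ 2))) := by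
  have hpos : ∀ w : ℝ, 0 < w ^ 2 + h ^ 2 := fun w => by positivity
  have hderiv : ∀ w ∈ Set.Ioo 0 R, HasDerivWithinAt (fun w => √(w ^ 2 + h ^ 2))
      (w / √(w ^ 2 + h ^ 2)) (Set.Ioo 0 R) w := by
    intro w _
    have h1 := ((hasDerivAt_pow 2 w).add_const (h ^ 2)).sqrt (hpos w).ne'
    refine (h1.congr_deriv ?_).hasDerivWithinAt
    have := Real.sqrt_pos.2 (hpos w)
    field_simp
    simp
  have hinj : Set.InjOn (fun w => √(w ^ 2 + h ^ 2)) (Set.Ioo 0 R) := by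
    intro w hw w' hw' heq
    have := (Real.sqrt_inj (hpos w).le (hpos w').le).1 heq
    exact (pow_left_inj₀ hw.1.le hw'.1.le two_ne_zero).1 (by linarith)
  rw [← image_sqrt_sq_add_sq hh hR,
    lintegral_image_eq_lintegral_abs_deriv_mul measurableSet_Ioo hderiv hinj]
  refine setLIntegral_congr_fun measurableSet_Ioo fun w hw => ?_
  have hs := Real.sqrt_pos.2 (hpos w)
  have hw0 := hw.1
  rw [Real.sq_sqrt (hpos w).le, add_sub_cancel_right, Real.sqrt_sq hw0.le, ← mul_assoc,
    ← mul_assoc, ← mul_assoc, ← ENNReal.ofReal_mul (abs_nonneg _), abs_of_pos (by positivity),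
    div_mul_cancel₀ _ hs.ne']

/-- Integration of a function of the distance to the drone over the intersection of the hovering
disk with a disk centred on its edge. -/
theorem lintegral_lens {h R ρ : ℝ} (hh : 0 < h) (hR : 0 < R) (hρ : 0 < ρ) {c e : Plane}
    (he : dist e c = R) {F : ℝ → ENNReal} (hF : Measurable F) :
    ∫⁻ x in Metric.closedBall e ρ ∩ Metric.closedBall c R, F (droneDist c h x) =
      ∫⁻ r in Set.Ioo h (√(h ^ 2 + R ^ 2)),
        ENNReal.ofReal r * (F r * ENNReal.ofReal (theta R ρ (√(r ^ 2 - h ^ 2)))) := by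
  -- The isometry `x ↦ U (x - c)` preserves area, sends `c` to `0` and sends `e` to the real number
  -- `R`.
  obtain ⟨U, hU⟩ := exists_linearIsometryEquiv_complex (e - c)
  rw [← dist_eq_norm, he] at hU
  have hmp : MeasurePreserving (fun x : Plane => U (x - c)) volume volume :=
    U.measurePreserving.comp (measurePreserving_sub_right volume c)
  have hemb : MeasurableEmbedding (fun x : Plane => U (x - c)) :=
    U.toHomeomorph.measurableEmbedding.comp (Homeomorph.subRight c).measurableEmbedding
  have hnorm : ∀ x, ‖U (x - c)‖ = dist x c := fun x => by rw [U.norm_map, dist_eq_norm]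
  have hnorm' : ∀ x, ‖U (x - c) - R‖ = dist x e := fun x => by
    rw [← hU, ← map_sub, U.norm_map, dist_eq_norm, sub_sub_sub_cancel_right]
  have hset : Metric.closedBall e ρ ∩ Metric.closedBall c R =
      (fun x : Plane => U (x - c)) ⁻¹' {z : ℂ | ‖z - R‖ ≤ ρ ∧ ‖z‖ ≤ R} := by
    ext x
    rw [Set.mem_preimage, Set.mem_ofPred_eq, hnorm, hnorm']
    rfl
  have hfun : ∀ x, F (droneDist c h x) = (fun z : ℂ => F (√(‖z‖ ^ 2 + h ^ 2))) (U (x - c)) := by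
    intro x
    simp only [hnorm, droneDist]
  simp_rw [hfun]
  rw [hset, hmp.setLIntegral_comp_preimage_emb hemb
      (fun z : ℂ => F (√(‖z‖ ^ 2 + h ^ 2))),
    lintegral_lens_complex hR hρ (F := fun w => F (√(w ^ 2 + h ^ 2)))
      (hF.comp (by fun_prop)),
    lintegral_comp_sqrt_sq_add_sq hh hR F fun w => ENNReal.ofReal (theta R ρ w)]

/-- The disk of radius `2 * R` about the edge point `e` contains the whole hovering disk, so this is
a lens with full angle. -/
theorem lintegral_disk {h R : ℝ} (hh : 0 < h) (hR : 0 < R) {c e : Plane}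
    (he : dist e c = R) {F : ℝ → ENNReal} (hF : Measurable F) :
    ∫⁻ x in Metric.closedBall c R, F (droneDist c h x) =
      ∫⁻ r in Set.Ioo h (√(h ^ 2 + R ^ 2)),
        ENNReal.ofReal r * (F r * ENNReal.ofReal (2 * Real.pi)) := by
  have hsub : Metric.closedBall c R ⊆ Metric.closedBall e (2 * R) :=
    Metric.closedBall_subset_closedBall' (by rw [dist_comm, he]; linarith)
  have h1 := lintegral_lens hh hR (mul_pos two_pos hR) he hF
  rw [Set.inter_eq_right.2 hsub] at h1
  rw [h1]
  refine setLIntegral_congr_fun measurableSet_Ioo fun r hr => ?_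
  have hr0 : 0 ≤ r := (hh.trans hr.1).le
  have hlt : √(r ^ 2 - h ^ 2) ≤ R := by
    rw [Real.sqrt_le_left hR.le]
    linarith [(Real.lt_sqrt hr0).1 hr.2]
  simp only [theta]
  rw [if_pos ⟨Real.sqrt_nonneg _, le_max_of_le_right (by linarith)⟩]

end Polar

/-! ### Laplace transform of the interference -/

section LaplaceTransform

open Classical in
/-- The contribution of a node at `x` with mark `τ` to the Laplace transform at `s` of the
interference from the hovering disk. -/
def markFactor (η s : ℝ) (c : Plane) (h R : ℝ) (x : Plane) (τ : Bool × ℝ) : ENNReal :=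
  if x ∈ Metric.closedBall c R ∧ τ.1 = true then
    ENNReal.ofReal (Real.exp (-(s * droneDist c h x ^ (-η)) * τ.2)) else 1

/-- The mean of `markFactor` over the mark. -/
def meanMarkFactor (a η s : ℝ) (m : ℕ) (c : Plane) (h R : ℝ) (x : Plane) : ℝ :=
  1 - (Metric.closedBall c R).indicator
    (fun x => a * (1 - (1 + s * droneDist c h x ^ (-η) / m) ^ (-(m : ℤ)))) x

lemma droneDist_nonneg (c : Plane) (h : ℝ) (x : Plane) : 0 ≤ droneDist c h x := Real.sqrt_nonneg _

lemma one_sub_one_add_zpow_mem_Icc (m : ℕ) {u : ℝ} (hu : 0 ≤ u) :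
    1 - (1 + u / m) ^ (-(m : ℤ)) ∈ Set.Icc (0 : ℝ) 1 := by
  have h1 : (1 : ℝ) ≤ 1 + u / m := le_add_of_nonneg_right (by positivity)
  have h2 : (1 : ℝ) ≤ (1 + u / m) ^ m := one_le_pow₀ h1
  rw [zpow_neg, zpow_natCast]
  exact ⟨sub_nonneg.2 (inv_le_one_of_one_le₀ h2), sub_le_self _ (by positivity)⟩

lemma meanMarkFactor_mem_Icc {a η s : ℝ} (ha0 : 0 ≤ a) (ha1 : a ≤ 1) (hs : 0 ≤ s) (m : ℕ)
    (c : Plane) (h R : ℝ) (x : Plane) : meanMarkFactor a η s m c h R x ∈ Set.Icc (0 : ℝ) 1 := by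
  unfold meanMarkFactor
  by_cases hx : x ∈ Metric.closedBall c R
  · rw [Set.indicator_of_mem hx]
    have h1 := one_sub_one_add_zpow_mem_Icc m
      (mul_nonneg hs (Real.rpow_nonneg (droneDist_nonneg c h x) (-η)))
    constructor
    · nlinarith [h1.1, h1.2]
    · nlinarith [mul_nonneg ha0 h1.1]
  · simp [Set.indicator_of_notMem hx]

lemma measurable_meanMarkFactor (a η s : ℝ) (m : ℕ) (c : Plane) (h R : ℝ) :
    Measurable (meanMarkFactor a η s m c h R) := by
  unfold meanMarkFactor
  refine measurable_const.sub (Measurable.indicator ?_ Metric.isClosed_closedBall.measurableSet)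
  have h1 := measurable_droneDist c h
  simp only [zpow_neg, zpow_natCast]
  fun_prop

lemma measurable_markFactor (η s : ℝ) (c : Plane) (h R : ℝ) :
    Measurable (fun p : Plane × Bool × ℝ => markFactor η s c h R p.1 p.2) := by
  unfold markFactor
  have h1 := measurable_droneDist c h
  refine Measurable.ite (MeasurableSet.inter ?_ ?_) (by fun_prop) measurable_const
  · exact measurable_fst Metric.isClosed_closedBall.measurableSet
  · exact (measurable_fst.comp measurable_snd) (measurableSet_singleton true)

variable {Ω : Type*} [MeasurableSpace Ω] {Pr : Measure Ω}
  {lam a : ℝ} {m : ℕ} {𝒜 : Set Plane}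
  {N : Ω → ℕ} {X : ℕ → Ω → Plane} {T : ℕ → Ω → Bool} {G : ℕ → Ω → ℝ}

lemma IsSlot.lintegral_decision [IsProbabilityMeasure Pr] (hs : IsSlot Pr lam a m 𝒜 N X T G) (i : ℕ) :
    ∫⁻ ω, (if T i ω = true then 1 else 0) ∂Pr = ENNReal.ofReal a := by
  have hT : MeasurableSet {ω | T i ω = true} :=
    hs.measurable_decision i (measurableSet_singleton true)
  have : (fun ω => if T i ω = true then (1 : ENNReal) else 0) =
      {ω | T i ω = true}.indicator 1 := by
    ext ω; simp [Set.indicator_apply]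
  rw [this, lintegral_indicator_one hT, ← hs.decision_law i, ofReal_measureReal]

lemma IsSlot.lintegral_markFactor [IsProbabilityMeasure Pr] (hs : IsSlot Pr lam a m 𝒜 N X T G) (ha0 : 0 ≤ a) (hm : 1 ≤ m)
    {s : ℝ} (hs0 : 0 ≤ s) (η : ℝ) (c : Plane) (h R : ℝ) (i : ℕ) (x : Plane) :
    ∫⁻ ω, markFactor η s c h R x (T i ω, G i ω) ∂Pr =
      ENNReal.ofReal (meanMarkFactor a η s m c h R x) := by
  by_cases hx : x ∈ Metric.closedBall c R
  · set u := s * droneDist c h x ^ (-η)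
    have hu : 0 ≤ u := mul_nonneg hs0 (Real.rpow_nonneg (droneDist_nonneg c h x) _)
    set τ : Bool → ENNReal := fun b => if b = true then 1 else 0
    have hτ : Measurable τ := measurable_of_countable _
    set E : ℝ → ENNReal := fun g => ENNReal.ofReal (Real.exp (-u * g))
    have hE : Measurable E := by fun_prop
    have hTm := hs.measurable_decision i
    have hGm := hs.measurable_gain i
    -- The factor is `τ * E + (1 - τ)`; adding `τ` to both sides avoids subtraction in `ENNReal`.
    have hpt : ∀ ω, markFactor η s c h R x (T i ω, G i ω) + τ (T i ω) =
        τ (T i ω) * E (G i ω) + 1 := by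
      intro ω
      by_cases hT : T i ω = true
      · simp [markFactor, hx, τ, hT, E, u]
      · simp [markFactor, τ, hT]
    have hind : IndepFun (fun ω => τ (T i ω)) (fun ω => E (G i ω)) Pr :=
      (hs.decision_indep_gain i).comp hτ hE
    have hGE : ∫⁻ ω, E (G i ω) ∂Pr = ENNReal.ofReal ((1 + u / m) ^ (-(m : ℤ))) := by
      rw [← lintegral_map hE hGm, hs.gain_law i, lintegral_exp_neg_mul_gammaMeasure hm hu]
    have hsum : ∫⁻ ω, markFactor η s c h R x (T i ω, G i ω) ∂Pr + ENNReal.ofReal a =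
        ENNReal.ofReal a * ENNReal.ofReal ((1 + u / m) ^ (-(m : ℤ))) + 1 := by
      have hTi : ∫⁻ ω, τ (T i ω) ∂Pr = ENNReal.ofReal a := hs.lintegral_decision i
      have hadd := lintegral_add_right (μ := Pr) (fun ω => markFactor η s c h R x (T i ω, G i ω))
        (show Measurable fun ω => τ (T i ω) from hτ.comp hTm)
      rw [← hTi, ← hadd]
      simp_rw [hpt]
      rw [lintegral_add_right _ measurable_const, lintegral_one, measure_univ,
        lintegral_mul_eq_lintegral_mul_lintegral_of_indepFun''
          (show Measurable fun ω => τ (T i ω) from hτ.comp hTm).aemeasurable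
          (show Measurable fun ω => E (G i ω) from hE.comp hGm).aemeasurable hind, hGE]
    have hpow : 0 ≤ (1 + u / m) ^ (-(m : ℤ)) := by positivity
    have ha1 : 0 ≤ meanMarkFactor a η s m c h R x := by
      have h1 : a ≤ 1 := hs.decision_law i ▸ measureReal_le_one
      exact (meanMarkFactor_mem_Icc ha0 h1 hs0 m c h R x).1
    refine (ENNReal.add_left_inj (ENNReal.ofReal_ne_top (r := a))).1 ?_
    rw [hsum, ← ENNReal.ofReal_add ha1 ha0, ← ENNReal.ofReal_mul ha0, ← ENNReal.ofReal_one,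
      ← ENNReal.ofReal_add (mul_nonneg ha0 hpow) zero_le_one]
    congr 1
    rw [meanMarkFactor, Set.indicator_of_mem hx]
    ring
  · simp [markFactor, meanMarkFactor, hx]

lemma ofReal_exp_interference (Pt η σ2 s : ℝ) (c : Plane) (h R : ℝ) (n : ℕ) (x : ℕ → Plane)
    (τ : ℕ → Bool × ℝ) (i : ℕ) :
    ENNReal.ofReal (Real.exp (-s * interference Pt η σ2 c h
      (active c R n x fun j => (τ j).1) x (fun j => (τ j).2) i)) =
    ENNReal.ofReal (Real.exp (-s * σ2 / Pt)) *
      ∏ j ∈ (Finset.range n).erase i, markFactor η s c h R (x j) (τ j) := by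
  classical
  have h1 : (active c R n x fun j => (τ j).1).erase i =
      ((Finset.range n).erase i).filter
        (fun j => x j ∈ Metric.closedBall c R ∧ (τ j).1 = true) := by
    unfold active
    rw [Finset.filter_erase]
  have h2 : -s * interference Pt η σ2 c h (active c R n x fun j => (τ j).1) x
      (fun j => (τ j).2) i = -s * σ2 / Pt +
        ∑ j ∈ (active c R n x fun j => (τ j).1).erase i,
          -(s * droneDist c h (x j) ^ (-η)) * (τ j).2 := by
    unfold interference
    rw [mul_add, add_comm, Finset.mul_sum]
    congr 1
    · ring
    · exact Finset.sum_congr rfl fun j _ => by ring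
  rw [h2, Real.exp_add, ENNReal.ofReal_mul (Real.exp_pos _).le, Real.exp_sum,
    ENNReal.ofReal_prod_of_nonneg (fun _ _ => (Real.exp_pos _).le), h1, Finset.prod_filter]
  rfl

lemma IsSlot.lintegral_decision_mul_prod_markFactor [IsProbabilityMeasure Pr] (hs : IsSlot Pr lam a m 𝒜 N X T G)
    (ha0 : 0 ≤ a) (hm : 1 ≤ m) {s : ℝ} (hs0 : 0 ≤ s) (η : ℝ) (c : Plane) (h R : ℝ) {n i : ℕ}
    (hi : i ∈ Finset.range n) (x : ℕ → Plane) :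
    ∫⁻ ω, (if T i ω = true then 1 else 0) *
      ∏ j ∈ (Finset.range n).erase i, markFactor η s c h R (x j) (T j ω, G j ω) ∂Pr =
    ENNReal.ofReal a *
      ∏ j ∈ (Finset.range n).erase i, ENNReal.ofReal (meanMarkFactor a η s m c h R (x j)) := by
  classical
  -- Index `i` carries the activity indicator and every other index its interference factor, so the
  -- integrand is one product of functions of independent marks.
  set ψ : ℕ → Bool × ℝ → ENNReal := fun j τ =>
    if j = i then (if τ.1 = true then 1 else 0) else markFactor η s c h R (x j) τ
  have hψ : ∀ j, Measurable (ψ j) := by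
    intro j
    by_cases hj : j = i
    · simp only [ψ, hj, if_true]
      exact Measurable.ite (measurable_fst (measurableSet_singleton true)) measurable_const
        measurable_const
    · simp only [ψ, hj, if_false]
      exact (measurable_markFactor η s c h R).comp (f := fun τ : Bool × ℝ => (x j, τ))
        measurable_prodMk_left
  have hτ : ∀ j, Measurable (fun ω => (T j ω, G j ω)) := fun j =>
    (hs.measurable_decision j).prodMk (hs.measurable_gain j)
  have hind : iIndepFun (fun j ω => ψ j (T j ω, G j ω)) Pr := hs.marks_indep.comp ψ hψ
  have key := lintegral_prod_eq_prod_lintegral_of_indepFun (Finset.range n) _ hind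
    fun j => (hψ j).comp (hτ j)
  have hi' : ∀ τ, ψ i τ = if τ.1 = true then 1 else 0 := fun τ => if_pos rfl
  have hj' : ∀ j ∈ (Finset.range n).erase i, ∀ τ, ψ j τ = markFactor η s c h R (x j) τ :=
    fun j hj τ => if_neg (Finset.ne_of_mem_erase hj)
  rw [← Finset.mul_prod_erase _ _ hi] at key
  simp_rw [← Finset.mul_prod_erase _ _ hi, hi'] at key
  rw [hs.lintegral_decision i] at key
  rw [← Finset.prod_congr rfl fun j hj => hs.lintegral_markFactor ha0 hm hs0 η c h R j (x j),
    ← Finset.prod_congr rfl fun j hj => lintegral_congr fun ω => hj' j hj (T j ω, G j ω), ← key]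
  refine lintegral_congr fun ω => ?_
  rw [Finset.prod_congr rfl fun j hj => hj' j hj (T j ω, G j ω)]

lemma IsHomogeneousPPP.lintegral_sum_prod_erase_meanMarkFactor
    (hp : IsHomogeneousPPP Pr lam 𝒜 N X) (hlam : 0 ≤ lam) (ha0 : 0 ≤ a) (ha1 : a ≤ 1)
    (h𝒜fin : volume 𝒜 ≠ ⊤) {s : ℝ} (hs0 : 0 ≤ s) (η : ℝ) {c e : Plane} {h R : ℝ}
    (hh : 0 < h) (hR : 0 < R) (hc : Metric.closedBall c R ⊆ 𝒜) (he : dist e c = R)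
    {B : Set Plane} (hB : MeasurableSet B) (hBc : B ⊆ Metric.closedBall c R) :
    ∫⁻ ω, ∑ i ∈ Finset.range (N ω), B.indicator 1 (X i ω) *
      ∏ j ∈ (Finset.range (N ω)).erase i,
        ENNReal.ofReal (meanMarkFactor a η s m c h R (X j ω)) ∂Pr =
    ENNReal.ofReal (lam * volume.real B * Real.exp (-2 * Real.pi * lam * a *
      ∫ r in h..√(h ^ 2 + R ^ 2), (1 - (1 + s * r ^ (-η) / m) ^ (-(m : ℤ))) * r)) := by
  set v := meanMarkFactor a η s m c h R
  have hv : Measurable v := measurable_meanMarkFactor a η s m c h R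
  have hv01 : ∀ x, v x ∈ Set.Icc (0 : ℝ) 1 := meanMarkFactor_mem_Icc ha0 ha1 hs0 m c h R
  have hbm : Measurable (B.indicator (1 : Plane → ℝ)) := measurable_one.indicator hB
  have hint : Integrable (fun ω => ∑ i ∈ Finset.range (N ω),
      B.indicator (1 : Plane → ℝ) (X i ω) *
        ∏ j ∈ (Finset.range (N ω)).erase i, v (X j ω)) Pr :=
    (integrable_pow_number hp (z := 4) (by norm_num)).mono'
      (measurable_sum_position_prod_erase hp hbm hv).aestronglyMeasurable
      (ae_of_all _ fun ω => abs_sum_indicator_mul_prod_erase_le (N ω) (fun i => X i ω) B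
        fun x => by rw [abs_of_nonneg (hv01 x).1]; linarith [(hv01 x).2])
  have hb0 : ∀ x, 0 ≤ B.indicator (1 : Plane → ℝ) x :=
    fun x => Set.indicator_nonneg (fun _ _ => zero_le_one) x
  have hterm : ∀ ω i, 0 ≤ B.indicator (1 : Plane → ℝ) (X i ω) *
      ∏ j ∈ (Finset.range (N ω)).erase i, v (X j ω) := fun ω i =>
    mul_nonneg (hb0 _) (Finset.prod_nonneg fun j _ => (hv01 _).1)
  have hconv : ∀ ω, ∑ i ∈ Finset.range (N ω), B.indicator (1 : Plane → ENNReal) (X i ω) *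
      ∏ j ∈ (Finset.range (N ω)).erase i, ENNReal.ofReal (v (X j ω)) =
      ENNReal.ofReal (∑ i ∈ Finset.range (N ω), B.indicator (1 : Plane → ℝ) (X i ω) *
        ∏ j ∈ (Finset.range (N ω)).erase i, v (X j ω)) := by
    intro ω
    rw [ENNReal.ofReal_sum_of_nonneg fun i _ => hterm ω i]
    refine Finset.sum_congr rfl fun i _ => ?_
    rw [ENNReal.ofReal_mul (hb0 _), ENNReal.ofReal_prod_of_nonneg fun j _ => (hv01 _).1]
    congr 1
    by_cases hx : X i ω ∈ B <;> simp [hx]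
  simp_rw [hconv]
  rw [← ofReal_integral_eq_lintegral_ofReal hint
      (ae_of_all _ fun ω => Finset.sum_nonneg fun i _ => hterm ω i),
    integral_sum_prod_erase hp hlam h𝒜fin hv hv01 hB,
    Set.inter_eq_left.2 (hBc.trans hc)]
  congr 3
  set q : ℝ → ℝ := fun r => 1 - (1 + s * r ^ (-η) / m) ^ (-(m : ℤ))
  have hq : Measurable q := by
    simp only [q, zpow_neg, zpow_natCast]
    fun_prop
  have hq0 : ∀ r, 0 ≤ r → 0 ≤ q r := fun r hr =>
    (one_sub_one_add_zpow_mem_Icc m (mul_nonneg hs0 (Real.rpow_nonneg hr (-η)))).1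
  -- Nodes outside the hovering disk never interfere, so `v = 1` there and the region `𝒜` drops out.
  have h1 : ∫ x in 𝒜, (v x - 1) = -(a * ∫ x in Metric.closedBall c R, q (droneDist c h x)) := by
    have : ∀ x, v x - 1 =
        -((Metric.closedBall c R).indicator (fun x => a * q (droneDist c h x)) x) := by
      intro x
      simp only [v, meanMarkFactor, q]
      ring
    simp_rw [this]
    rw [integral_neg, setIntegral_indicator Metric.isClosed_closedBall.measurableSet,
      Set.inter_eq_right.2 hc, integral_const_mul]
  have hle : h ≤ √(h ^ 2 + R ^ 2) := Real.le_sqrt_of_sq_le (by nlinarith)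
  have h2 : ∫ x in Metric.closedBall c R, q (droneDist c h x) =
      2 * Real.pi * ∫ r in h..√(h ^ 2 + R ^ 2), q r * r := by
    have hm1 := measurable_droneDist c h
    rw [integral_eq_lintegral_of_nonneg_ae
        (ae_of_all _ fun x => hq0 _ (droneDist_nonneg c h x))
        (hq.comp hm1).aestronglyMeasurable,
      lintegral_disk hh hR he (F := fun r => ENNReal.ofReal (q r)) hq.ennreal_ofReal,
      intervalIntegral.integral_of_le hle, integral_Ioc_eq_integral_Ioo, ← integral_const_mul,
      integral_eq_lintegral_of_nonneg_ae _ (by fun_prop)]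
    · congr 1
      refine setLIntegral_congr_fun measurableSet_Ioo fun r hr => ?_
      have hr0 : 0 ≤ r := (hh.trans hr.1).le
      rw [← ENNReal.ofReal_mul (hq0 r hr0), ← ENNReal.ofReal_mul hr0]
      congr 1
      ring
    · refine (ae_restrict_iff' measurableSet_Ioo).2 (ae_of_all _ fun r hr => ?_)
      have hr0 : 0 ≤ r := (hh.trans hr.1).le
      exact mul_nonneg (by positivity) (mul_nonneg (hq0 r hr0) hr0)
  rw [h1, h2]
  ring

/-- The Laplace transform of the interference seen by the active nodes in `B`. -/
theorem IsSlot.lintegral_sum_active_exp_interference [IsProbabilityMeasure Pr] (hs : IsSlot Pr lam a m 𝒜 N X T G)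
    (hlam : 0 ≤ lam) (ha0 : 0 ≤ a) (ha1 : a ≤ 1) (hm : 1 ≤ m) (h𝒜fin : volume 𝒜 ≠ ⊤)
    {s : ℝ} (hs0 : 0 ≤ s) (Pt η σ2 : ℝ) {c e : Plane} {h R : ℝ}
    (hh : 0 < h) (hR : 0 < R) (hc : Metric.closedBall c R ⊆ 𝒜) (he : dist e c = R)
    {B : Set Plane} (hB : MeasurableSet B) (hBc : B ⊆ Metric.closedBall c R) :
    ∫⁻ ω, ∑ i ∈ active c R (N ω) (fun j => X j ω) (fun j => T j ω),
      B.indicator 1 (X i ω) * ENNReal.ofReal (Real.exp (-s * interference Pt η σ2 c h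
        (active c R (N ω) (fun j => X j ω) (fun j => T j ω))
        (fun j => X j ω) (fun j => G j ω) i)) ∂Pr =
    ENNReal.ofReal (a * lam * volume.real B * laplaceI lam a Pt η σ2 h R m s) := by
  classical
  set K := ENNReal.ofReal (Real.exp (-s * σ2 / Pt))
  set F : (ℕ × (ℕ → Plane)) × (ℕ → Bool × ℝ) → ENNReal := fun p =>
    ∑ i ∈ Finset.range p.1.1, B.indicator 1 (p.1.2 i) * (K * ((if (p.2 i).1 = true then 1 else 0) *
      ∏ j ∈ (Finset.range p.1.1).erase i, markFactor η s c h R (p.1.2 j) (p.2 j)))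
  have hBm : Measurable (B.indicator (1 : Plane → ENNReal)) := measurable_one.indicator hB
  have hdec : Measurable (fun τ : Bool × ℝ => if τ.1 = true then (1 : ENNReal) else 0) :=
    Measurable.ite (measurable_fst (measurableSet_singleton true)) measurable_const
      measurable_const
  have hmf := measurable_markFactor η s c h R
  have hF : Measurable F := by
    have h1 : Measurable (fun p : ℕ × ((ℕ → Plane) × (ℕ → Bool × ℝ)) => F ((p.1, p.2.1), p.2.2)) := by
      refine measurable_from_prod_countable_right fun n => ?_
      change Measurable fun p : (ℕ → Plane) × (ℕ → Bool × ℝ) =>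
        ∑ i ∈ Finset.range n, B.indicator 1 (p.1 i) * (K * ((if (p.2 i).1 = true then 1 else 0) *
          ∏ j ∈ (Finset.range n).erase i, markFactor η s c h R (p.1 j) (p.2 j)))
      refine Finset.measurable_fun_sum _ fun i _ => ?_
      refine (hBm.comp (f := fun p : (ℕ → Plane) × (ℕ → Bool × ℝ) => p.1 i) (by fun_prop)).mul
        (measurable_const.mul ((hdec.comp
          (f := fun p : (ℕ → Plane) × (ℕ → Bool × ℝ) => p.2 i) (by fun_prop)).mul ?_))
      exact Finset.measurable_fun_prod _ fun j _ =>
        hmf.comp (f := fun p : (ℕ → Plane) × (ℕ → Bool × ℝ) => (p.1 j, p.2 j)) (by fun_prop)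
    exact h1.comp (f := fun p : (ℕ × (ℕ → Plane)) × (ℕ → Bool × ℝ) => (p.1.1, (p.1.2, p.2)))
      (by fun_prop)
  have hpt : ∀ ω, ∑ i ∈ active c R (N ω) (fun j => X j ω) (fun j => T j ω),
      B.indicator 1 (X i ω) * ENNReal.ofReal (Real.exp (-s * interference Pt η σ2 c h
        (active c R (N ω) (fun j => X j ω) (fun j => T j ω))
        (fun j => X j ω) (fun j => G j ω) i)) =
      F ((N ω, fun j => X j ω), fun j => (T j ω, G j ω)) := by
    intro ω
    rw [active, Finset.sum_filter]
    refine Finset.sum_congr rfl fun i _ => ?_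
    by_cases hx : X i ω ∈ B
    · have hxc := hBc hx
      by_cases hT : T i ω = true
      · have := ofReal_exp_interference Pt η σ2 s c h R (N ω) (fun j => X j ω)
          (fun j => (T j ω, G j ω)) i
        simp only [active] at this
        rw [if_pos ⟨hxc, hT⟩, if_pos hT, one_mul, ← this]
      · simp [hT]
    · simp [hx]
  have hX : Measurable (fun ω => (N ω, fun j => X j ω)) :=
    hs.nodes.measurable_number.prodMk (measurable_pi_lambda _ hs.nodes.measurable_position)
  have hτ : Measurable (fun ω j => (T j ω, G j ω)) := measurable_pi_lambda _ fun j =>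
    (hs.measurable_decision j).prodMk (hs.measurable_gain j)
  have := Measure.isProbabilityMeasure_map (μ := Pr) hτ.aemeasurable
  simp_rw [hpt]
  -- Marks are independent of positions: average over the marks with the configuration frozen, then
  -- over the configuration.
  rw [← lintegral_map (f := F) hF (hX.prodMk hτ),
    (indepFun_iff_map_prod_eq_prod_map_map hX.aemeasurable hτ.aemeasurable).1
      hs.marks_indep_nodes, lintegral_prod _ hF.aemeasurable,
    lintegral_map hF.lintegral_prod_right' hX]
  have hinner : ∀ ω, ∫⁻ τ, F ((N ω, fun j => X j ω), τ) ∂(Pr.map fun ω j => (T j ω, G j ω)) =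
      K * ENNReal.ofReal a * ∑ i ∈ Finset.range (N ω), B.indicator 1 (X i ω) *
        ∏ j ∈ (Finset.range (N ω)).erase i,
          ENNReal.ofReal (meanMarkFactor a η s m c h R (X j ω)) := by
    intro ω
    have hmeas : ∀ i, Measurable fun ω' => (if T i ω' = true then (1 : ENNReal) else 0) *
        ∏ j ∈ (Finset.range (N ω)).erase i, markFactor η s c h R (X j ω) (T j ω', G j ω') :=
      fun i => (hdec.comp ((measurable_pi_apply i).comp hτ)).mul
        (Finset.measurable_fun_prod _ fun j _ =>
          hmf.comp (f := fun ω' => (X j ω, (T j ω', G j ω')))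
            (measurable_const.prodMk ((measurable_pi_apply j).comp hτ)))
    rw [lintegral_map (f := fun τ => F ((N ω, fun j => X j ω), τ))
      (hF.comp measurable_prodMk_left) hτ]
    simp only [F]
    rw [lintegral_finsetSum _ fun i _ => ((hmeas i).const_mul _).const_mul _, Finset.mul_sum]
    refine Finset.sum_congr rfl fun i hi => ?_
    rw [lintegral_const_mul _ ((hmeas i).const_mul _), lintegral_const_mul _ (hmeas i),
      hs.lintegral_decision_mul_prod_markFactor ha0 hm hs0 η c h R hi fun j => X j ω]
    ring
  simp_rw [hinner]
  rw [lintegral_const_mul' _ _ (ENNReal.mul_ne_top ENNReal.ofReal_ne_top ENNReal.ofReal_ne_top),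
    hs.nodes.lintegral_sum_prod_erase_meanMarkFactor hlam ha0 ha1 h𝒜fin hs0 η hh hR hc he hB hBc,
    ← ENNReal.ofReal_mul (Real.exp_pos _).le, ← ENNReal.ofReal_mul (by positivity)]
  congr 1
  unfold laplaceI
  ring

end LaplaceTransform

/-! ### Uniqueness of the Laplace transform -/

section LaplaceUniqueness

/-- Finite measures on `[0, 1]` with the same moments are equal. -/
lemma measure_ext_of_moments {μ ν : Measure ℝ} [IsFiniteMeasure μ] [IsFiniteMeasure ν]
    (hμ : ∀ᵐ x ∂μ, x ∈ Set.Icc (0 : ℝ) 1) (hν : ∀ᵐ x ∂ν, x ∈ Set.Icc (0 : ℝ) 1)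
    (h : ∀ k : ℕ, ∫ x, x ^ k ∂μ = ∫ x, x ^ k ∂ν) : μ = ν := by
  have hpow : ∀ (ρ : Measure ℝ) [IsFiniteMeasure ρ], (∀ᵐ x ∂ρ, x ∈ Set.Icc (0 : ℝ) 1) →
      ∀ k : ℕ, Integrable (fun x : ℝ => x ^ k) ρ := by
    intro ρ _ hρ k
    refine (integrable_const (1 : ℝ)).mono' (by fun_prop) (hρ.mono fun x hx => ?_)
    rw [Real.norm_of_nonneg (pow_nonneg hx.1 k)]
    exact pow_le_one₀ hx.1 hx.2
  have hpolyint : ∀ (ρ : Measure ℝ) [IsFiniteMeasure ρ], (∀ᵐ x ∂ρ, x ∈ Set.Icc (0 : ℝ) 1) →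
      ∀ p : Polynomial ℝ, Integrable (fun x => p.eval x) ρ := by
    intro ρ _ hρ p
    simp_rw [Polynomial.eval_eq_sum_range]
    exact integrable_finsetSum _ fun k _ => (hpow ρ hρ k).const_mul _
  have hpoly : ∀ p : Polynomial ℝ, ∫ x, p.eval x ∂μ = ∫ x, p.eval x ∂ν := by
    intro p
    simp_rw [Polynomial.eval_eq_sum_range]
    rw [integral_finsetSum _ fun k _ => (hpow μ hμ k).const_mul _,
      integral_finsetSum _ fun k _ => (hpow ν hν k).const_mul _]
    simp_rw [integral_const_mul, h]
  refine ext_of_forall_integral_eq_of_IsFiniteMeasure fun f => ?_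
  have hclose : ∀ (ρ : Measure ℝ) [IsFiniteMeasure ρ], (∀ᵐ x ∂ρ, x ∈ Set.Icc (0 : ℝ) 1) →
      ∀ (p : Polynomial ℝ) (δ : ℝ), (∀ x ∈ Set.Icc (0 : ℝ) 1, |p.eval x - f x| < δ) →
      |∫ x, p.eval x ∂ρ - ∫ x, f x ∂ρ| ≤ δ * ρ.real Set.univ := by
    intro ρ _ hρ p δ hp
    rw [← integral_sub (hpolyint ρ hρ p) (f.integrable ρ), ← Real.norm_eq_abs]
    exact norm_integral_le_of_norm_le_const (hρ.mono fun x hx => (hp x hx).le)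
  set C := μ.real Set.univ + ν.real Set.univ
  have hC : 0 ≤ C := by positivity
  refine eq_of_forall_dist_le fun ε hε => ?_
  -- Weierstrass approximation; the two errors sum to at most `ε / (C + 1) * C`, with `C + 1`
  -- guarding against `C = 0`.
  obtain ⟨p, hp⟩ := exists_polynomial_near_of_continuousOn 0 1 f f.continuous.continuousOn
    (ε / (C + 1)) (by positivity)
  have h1 := hclose μ hμ p _ hp
  have h2 := hclose ν hν p _ hp
  rw [hpoly p] at h1
  have h3 : ε / (C + 1) * C ≤ ε := by
    rw [div_mul_eq_mul_div, div_le_iff₀ (by positivity)]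
    nlinarith
  rw [Real.dist_eq]
  calc |∫ x, f x ∂μ - ∫ x, f x ∂ν|
      ≤ |∫ x, p.eval x ∂ν - ∫ x, f x ∂μ| + |∫ x, p.eval x ∂ν - ∫ x, f x ∂ν| := by
        rw [abs_sub_comm (∫ x, p.eval x ∂ν) (∫ x, f x ∂μ)]
        exact abs_sub_le _ _ _
    _ ≤ ε / (C + 1) * C := by linarith [mul_add (ε / (C + 1)) (μ.real Set.univ) (ν.real Set.univ)]
    _ ≤ ε := h3

/-- Finite measures on `[0, ∞)` with the same Laplace transform are equal. -/
theorem measure_ext_of_laplace {μ ν : Measure ℝ} [IsFiniteMeasure μ] [IsFiniteMeasure ν]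
    (hμ : ∀ᵐ x ∂μ, 0 ≤ x) (hν : ∀ᵐ x ∂ν, 0 ≤ x)
    (h : ∀ s : ℝ, 0 ≤ s → ∫⁻ x, ENNReal.ofReal (Real.exp (-s * x)) ∂μ =
      ∫⁻ x, ENNReal.ofReal (Real.exp (-s * x)) ∂ν) : μ = ν := by
  -- Pushing forward along `x ↦ exp (-x)` lands in `[0, 1]`, and the `k`-th moment becomes the
  -- transform at `s = k`. The map `-log` undoes the push-forward.
  have hE : Measurable (fun x : ℝ => Real.exp (-x)) := by fun_prop
  have hsupp : ∀ ρ : Measure ℝ, (∀ᵐ x ∂ρ, 0 ≤ x) →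
      ∀ᵐ y ∂(ρ.map fun x => Real.exp (-x)), y ∈ Set.Icc (0 : ℝ) 1 := by
    intro ρ hρ
    refine (ae_map_iff hE.aemeasurable (p := (· ∈ Set.Icc (0 : ℝ) 1)) measurableSet_Icc).2 ?_
    exact hρ.mono fun x hx => ⟨(Real.exp_pos _).le, Real.exp_le_one_iff.2 (neg_nonpos.2 hx)⟩
  have hback : ∀ ρ : Measure ℝ, (ρ.map fun x => Real.exp (-x)).map (fun y => -Real.log y) = ρ := by
    intro ρ
    rw [Measure.map_map (by fun_prop) hE]
    convert Measure.map_id using 1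
    congr 1
    ext x
    simp
  have hmom : ∀ (ρ : Measure ℝ) (k : ℕ), ∫ y, y ^ k ∂(ρ.map fun x => Real.exp (-x)) =
      (∫⁻ x, ENNReal.ofReal (Real.exp (-(k : ℝ) * x)) ∂ρ).toReal := by
    intro ρ k
    rw [integral_map hE.aemeasurable (by fun_prop), integral_eq_lintegral_of_nonneg_ae
      (ae_of_all _ fun x => by positivity) (by fun_prop)]
    congr 1
    refine lintegral_congr fun x => ?_
    rw [← Real.exp_nat_mul]
    congr 2
    ring
  rw [← hback μ, ← hback ν]
  congr 1
  refine measure_ext_of_moments (hsupp μ hμ) (hsupp ν hν) fun k => ?_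
  rw [hmom, hmom, h k (Nat.cast_nonneg k)]

end LaplaceUniqueness

/-! ### The Campbell measure of active nodes and their interference -/

section PalmMeasure

variable {Ω : Type*} [MeasurableSpace Ω] {Pr : Measure Ω}
  {lam a : ℝ} {m : ℕ} {𝒜 : Set Plane}
  {N : Ω → ℕ} {X : ℕ → Ω → Plane} {T : ℕ → Ω → Bool} {G : ℕ → Ω → ℝ}

/-- The Campbell measure of the active nodes together with the interference they see. -/
def activeMeasure (Pr : Measure Ω) (Pt η σ2 : ℝ) (c : Plane) (h R : ℝ)
    (N : Ω → ℕ) (X : ℕ → Ω → Plane) (T : ℕ → Ω → Bool) (G : ℕ → Ω → ℝ) : Measure (Plane × ℝ) :=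
  Measure.sum fun i : ℕ =>
    (Pr.restrict {ω | i ∈ active c R (N ω) (fun j => X j ω) (fun j => T j ω)}).map
      fun ω => (X i ω, interference Pt η σ2 c h
        (active c R (N ω) (fun j => X j ω) (fun j => T j ω))
        (fun j => X j ω) (fun j => G j ω) i)

lemma IsSlot.measurable_interference (hs : IsSlot Pr lam a m 𝒜 N X T G)
    (Pt η σ2 : ℝ) (c : Plane) (h R : ℝ) (i : ℕ) :
    Measurable fun ω => interference Pt η σ2 c h
      (active c R (N ω) (fun j => X j ω) (fun j => T j ω))
      (fun j => X j ω) (fun j => G j ω) i := by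
  have heq : ∀ ω, interference Pt η σ2 c h
      (active c R (N ω) (fun j => X j ω) (fun j => T j ω))
      (fun j => X j ω) (fun j => G j ω) i = totalInterference Pt η σ2 c h R
        (N ω, fun j => X j ω, Function.update (fun j => (T j ω, G j ω)) i (false, 0)) := fun ω =>
    interference_eq_totalInterference Pt η σ2 c h R (N ω) (fun j => X j ω)
      (fun j => (T j ω, G j ω)) i
  simp_rw [heq]
  refine (measurable_totalInterference Pt η σ2 c h R).comp
    (hs.nodes.measurable_number.prodMk
      ((measurable_pi_lambda _ hs.nodes.measurable_position).prodMk ?_))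
  refine measurable_pi_lambda _ fun j => ?_
  by_cases hj : j = i
  · subst hj; simp
  · simpa [Function.update_of_ne hj] using (hs.measurable_decision j).prodMk (hs.measurable_gain j)

lemma IsSlot.measurableSet_active (hs : IsSlot Pr lam a m 𝒜 N X T G) (c : Plane) (R : ℝ) (i : ℕ) :
    MeasurableSet {ω | i ∈ active c R (N ω) (fun j => X j ω) (fun j => T j ω)} := by
  classical
  have : {ω | i ∈ active c R (N ω) (fun j => X j ω) (fun j => T j ω)} =
      N ⁻¹' Set.Ioi i ∩ (X i ⁻¹' Metric.closedBall c R ∩ T i ⁻¹' {true}) := by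
    ext ω; simp [active]
  rw [this]
  exact (hs.nodes.measurable_number measurableSet_Ioi).inter
    ((hs.nodes.measurable_position i Metric.isClosed_closedBall.measurableSet).inter
      (hs.measurable_decision i (measurableSet_singleton true)))

/-- Replaces a sum over a random index set by a series over fixed indices, so that independence can
be used one node at a time. -/
lemma IsSlot.lintegral_sum_active (hs : IsSlot Pr lam a m 𝒜 N X T G) (c : Plane) (R : ℝ)
    {f : ℕ → Ω → ENNReal} (hf : ∀ i, Measurable (f i)) :
    ∫⁻ ω, ∑ i ∈ active c R (N ω) (fun j => X j ω) (fun j => T j ω), f i ω ∂Pr =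
      ∑' i, ∫⁻ ω in {ω | i ∈ active c R (N ω) (fun j => X j ω) (fun j => T j ω)}, f i ω ∂Pr := by
  classical
  have hA := hs.measurableSet_active c R
  simp_rw [← lintegral_indicator (hA _)]
  rw [← lintegral_tsum fun i => ((hf i).indicator (hA i)).aemeasurable]
  refine lintegral_congr fun ω => ?_
  rw [tsum_eq_sum (s := active c R (N ω) (fun j => X j ω) (fun j => T j ω))]
  · exact Finset.sum_congr rfl fun i hi => (Set.indicator_of_mem (by exact hi) _).symm
  · exact fun i hi => Set.indicator_of_notMem (by exact hi) _

lemma IsSlot.lintegral_activeMeasure (hs : IsSlot Pr lam a m 𝒜 N X T G)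
    (Pt η σ2 : ℝ) (c : Plane) (h R : ℝ) {f : Plane × ℝ → ENNReal} (hf : Measurable f) :
    ∫⁻ p, f p ∂(activeMeasure Pr Pt η σ2 c h R N X T G) =
      ∫⁻ ω, ∑ i ∈ active c R (N ω) (fun j => X j ω) (fun j => T j ω),
        f (X i ω, interference Pt η σ2 c h
          (active c R (N ω) (fun j => X j ω) (fun j => T j ω))
          (fun j => X j ω) (fun j => G j ω) i) ∂Pr := by
  set I : ℕ → Ω → ℝ := fun i ω => interference Pt η σ2 c h
    (active c R (N ω) (fun j => X j ω) (fun j => T j ω))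
    (fun j => X j ω) (fun j => G j ω) i
  have hmeas : ∀ i, Measurable fun ω => (X i ω, I i ω) := fun i =>
    (hs.nodes.measurable_position i).prodMk (hs.measurable_interference Pt η σ2 c h R i)
  refine Eq.trans ?_ (hs.lintegral_sum_active c R (f := fun i ω => f (X i ω, I i ω))
    fun i => hf.comp (hmeas i)).symm
  rw [activeMeasure, lintegral_sum_measure]
  exact tsum_congr fun i => lintegral_map hf (hmeas i)

/-- The gain of an active node is independent of its position and of the interference it sees. -/
lemma IsSlot.lintegral_sum_active_gain [IsProbabilityMeasure Pr]
    (hs : IsSlot Pr lam a m 𝒜 N X T G)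
    (Pt η σ2 : ℝ) (c : Plane) (h R : ℝ) {f : Plane × ℝ → ℝ → ENNReal}
    (hf : Measurable (Function.uncurry f)) :
    ∫⁻ ω, ∑ i ∈ active c R (N ω) (fun j => X j ω) (fun j => T j ω),
        f (X i ω, interference Pt η σ2 c h
          (active c R (N ω) (fun j => X j ω) (fun j => T j ω))
          (fun j => X j ω) (fun j => G j ω) i) (G i ω) ∂Pr =
      ∫⁻ p, ∫⁻ g, f p g ∂(gammaMeasure m m) ∂(activeMeasure Pr Pt η σ2 c h R N X T G) := by
  classical
  have hprob : IsProbabilityMeasure (gammaMeasure m m) :=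
    hs.gain_law 0 ▸ Measure.isProbabilityMeasure_map (hs.measurable_gain 0).aemeasurable
  set I : ℕ → Ω → ℝ := fun i ω => interference Pt η σ2 c h
    (active c R (N ω) (fun j => X j ω) (fun j => T j ω))
    (fun j => X j ω) (fun j => G j ω) i
  have hmeas : ∀ i, Measurable fun ω => (X i ω, I i ω) := fun i =>
    (hs.nodes.measurable_position i).prodMk (hs.measurable_interference Pt η σ2 c h R i)
  have hfγ : Measurable fun p => ∫⁻ g, f p g ∂(gammaMeasure m m) := hf.lintegral_prod_right'
  rw [hs.lintegral_activeMeasure Pt η σ2 c h R hfγ]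
  refine (hs.lintegral_sum_active c R (f := fun i ω => f (X i ω, I i ω) (G i ω))
    fun i => hf.comp ((hmeas i).prodMk (hs.measurable_gain i))).trans (Eq.trans ?_
    (hs.lintegral_sum_active c R
      (f := fun i ω => ∫⁻ g, f (X i ω, I i ω) g ∂(gammaMeasure m m))
      fun i => hfγ.comp (hmeas i)).symm)
  refine tsum_congr fun i => ?_
  have hA := hs.measurableSet_active c R i
  rw [← lintegral_indicator hA, ← lintegral_indicator hA]
  -- `Z` collects data independent of `G i` that determine whether node `i` is active (the set `S`)
  -- and its position and interference (the map `q`).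
  set Z : Ω → (Bool × (ℕ → Bool × ℝ)) × (ℕ × (ℕ → Plane)) := fun ω => ((T i ω,
      Function.update (fun j => (T j ω, G j ω)) i (false, 0)), (N ω, fun j => X j ω)) with hZdef
  set S : Set ((Bool × (ℕ → Bool × ℝ)) × (ℕ × (ℕ → Plane))) :=
    {z | i < z.2.1 ∧ z.2.2 i ∈ Metric.closedBall c R ∧ z.1.1 = true}
  have hS : MeasurableSet S := by
    refine MeasurableSet.inter ?_ (MeasurableSet.inter ?_ ?_)
    · exact (measurable_fst.comp measurable_snd) measurableSet_Ioi
    · exact ((measurable_pi_apply i).comp (measurable_snd.comp measurable_snd))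
        Metric.isClosed_closedBall.measurableSet
    · exact (measurable_fst.comp measurable_fst) (measurableSet_singleton true)
  set q : (Bool × (ℕ → Bool × ℝ)) × (ℕ × (ℕ → Plane)) → Plane × ℝ := fun z =>
    (z.2.2 i, totalInterference Pt η σ2 c h R (z.2.1, z.2.2, z.1.2))
  have hq : Measurable q := by
    have := measurable_totalInterference Pt η σ2 c h R
    fun_prop
  have hZ : Measurable Z := by
    have hupd : Measurable fun ω => Function.update (fun j => (T j ω, G j ω)) i (false, 0) := by
      refine measurable_pi_lambda _ fun j => ?_
      by_cases hj : j = i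
      · subst hj; simp
      · simpa [Function.update_of_ne hj] using
          (hs.measurable_decision j).prodMk (hs.measurable_gain j)
    exact ((hs.measurable_decision i).prodMk hupd).prodMk
      (hs.nodes.measurable_number.prodMk (measurable_pi_lambda _ hs.nodes.measurable_position))
  have hZA : ∀ ω, Z ω ∈ S ↔ i ∈ active c R (N ω) (fun j => X j ω) (fun j => T j ω) := by
    intro ω; simp [S, Z, active]
  have hZq : ∀ ω, q (Z ω) = (X i ω, I i ω) := fun ω =>
    Prod.ext rfl (interference_eq_totalInterference Pt η σ2 c h R (N ω) (fun j => X j ω)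
      (fun j => (T j ω, G j ω)) i).symm
  set Φ : ((Bool × (ℕ → Bool × ℝ)) × (ℕ × (ℕ → Plane))) × ℝ → ENNReal :=
    (Prod.fst ⁻¹' S).indicator fun p => f (q p.1) p.2
  have hΦ : Measurable Φ :=
    (hf.comp (f := fun p : ((Bool × (ℕ → Bool × ℝ)) × (ℕ × (ℕ → Plane))) × ℝ => (q p.1, p.2))
      ((hq.comp measurable_fst).prodMk measurable_snd)).indicator (measurable_fst hS)
  have hmap := (indepFun_iff_map_prod_eq_prod_map_map hZ.aemeasurable
    (hs.measurable_gain i).aemeasurable).1 (hs.indepFun_gain i).symm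
  rw [hs.gain_law i] at hmap
  have := Measure.isProbabilityMeasure_map (μ := Pr) hZ.aemeasurable
  calc _ = ∫⁻ ω, Φ (Z ω, G i ω) ∂Pr := by
        refine lintegral_congr fun ω => ?_
        by_cases hω : i ∈ active c R (N ω) (fun j => X j ω) (fun j => T j ω)
        · simp only [Φ]
          rw [Set.indicator_of_mem (by exact hω),
            Set.indicator_of_mem (show (Z ω, G i ω) ∈ Prod.fst ⁻¹' S from (hZA ω).2 hω), hZq ω]
        · simp only [Φ]
          rw [Set.indicator_of_notMem (by exact hω), Set.indicator_of_notMem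
            (show (Z ω, G i ω) ∉ Prod.fst ⁻¹' S from fun hc => hω ((hZA ω).1 hc))]
    _ = ∫⁻ z, ∫⁻ g, Φ (z, g) ∂(gammaMeasure m m) ∂(Pr.map Z) := by
        rw [← lintegral_map (f := Φ) hΦ (hZ.prodMk (hs.measurable_gain i)), hmap,
          lintegral_prod _ hΦ.aemeasurable]
    _ = ∫⁻ ω, ∫⁻ g, Φ (Z ω, g) ∂(gammaMeasure m m) ∂Pr :=
        lintegral_map hΦ.lintegral_prod_right' hZ
    _ = _ := by
        refine lintegral_congr fun ω => ?_
        by_cases hω : i ∈ active c R (N ω) (fun j => X j ω) (fun j => T j ω)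
        · rw [Set.indicator_of_mem (by exact hω)]
          refine lintegral_congr fun g => ?_
          simp only [Φ]
          rw [Set.indicator_of_mem (show (Z ω, g) ∈ Prod.fst ⁻¹' S from (hZA ω).2 hω), hZq ω]
        · rw [Set.indicator_of_notMem (by exact hω)]
          refine (lintegral_congr fun g => ?_).trans lintegral_zero
          exact Set.indicator_of_notMem
            (show (Z ω, g) ∉ Prod.fst ⁻¹' S from fun hc => hω ((hZA ω).1 hc)) _

lemma IsSlot.ae_gain_nonneg (hs : IsSlot Pr lam a m 𝒜 N X T G) :
    ∀ᵐ ω ∂Pr, ∀ i, 0 ≤ G i ω := by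
  refine ae_all_iff.2 fun i => ?_
  have h1 : ∀ᵐ g ∂(Pr.map (G i)), 0 ≤ g := by
    rw [hs.gain_law i, ae_iff]
    simp only [not_le]
    exact gammaMeasure_Iio_zero m m
  exact ae_of_ae_map (hs.measurable_gain i).aemeasurable h1

lemma interference_pos {Pt η σ2 : ℝ} (hPt : 0 < Pt) (hσ2 : 0 < σ2) (c : Plane) (h : ℝ)
    (S : Finset ℕ) (x : ℕ → Plane) {g : ℕ → ℝ} (hg : ∀ i, 0 ≤ g i) (i : ℕ) :
    0 < interference Pt η σ2 c h S x g i :=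
  add_pos_of_nonneg_of_pos (Finset.sum_nonneg fun j _ =>
    mul_nonneg (hg j) (Real.rpow_nonneg (droneDist_nonneg c h _) _)) (div_pos hσ2 hPt)

end PalmMeasure

/-! ### Product form of the Campbell measure -/

section PalmDistribution

lemma laplaceI_pos (lam a Pt η σ2 h R : ℝ) (m : ℕ) (s : ℝ) : 0 < laplaceI lam a Pt η σ2 h R m s :=
  mul_pos (Real.exp_pos _) (Real.exp_pos _)

variable {Ω : Type*} [MeasurableSpace Ω] {Pr : Measure Ω} [IsProbabilityMeasure Pr]
  {lam a : ℝ} {m : ℕ} {𝒜 : Set Plane}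
  {N : Ω → ℕ} {X : ℕ → Ω → Plane} {T : ℕ → Ω → Bool} {G : ℕ → Ω → ℝ}

/-- The Campbell measure of the active nodes is a product: the interference seen by an active node
does not depend on its position. -/
theorem IsSlot.exists_activeMeasure_eq_prod (hs : IsSlot Pr lam a m 𝒜 N X T G)
    (hlam : 0 ≤ lam) (ha0 : 0 ≤ a) (ha1 : a ≤ 1) (hm : 1 ≤ m) (h𝒜fin : volume 𝒜 ≠ ⊤)
    {Pt σ2 : ℝ} (hPt : 0 < Pt) (hσ2 : 0 < σ2) (η : ℝ) {c e : Plane} {h R : ℝ}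
    (hh : 0 < h) (hR : 0 < R) (hc : Metric.closedBall c R ⊆ 𝒜) (he : dist e c = R) :
    ∃ ν : Measure ℝ, IsFiniteMeasure ν ∧ (∀ᵐ t ∂ν, 0 ≤ t) ∧
      (∀ s : ℝ, 0 ≤ s → ∫⁻ t, ENNReal.ofReal (Real.exp (-s * t)) ∂ν =
        ENNReal.ofReal (a * lam * laplaceI lam a Pt η σ2 h R m s)) ∧
      activeMeasure Pr Pt η σ2 c h R N X T G =
        (volume.restrict (Metric.closedBall c R)).prod ν := by
  classical
  set M := activeMeasure Pr Pt η σ2 c h R N X T G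
  set C := Metric.closedBall c R
  set L := laplaceI lam a Pt η σ2 h R m
  have hC : MeasurableSet C := Metric.isClosed_closedBall.measurableSet
  have hCtop : volume C ≠ ⊤ := measure_closedBall_lt_top.ne
  have hC0 : volume C ≠ 0 := (Metric.measure_closedBall_pos volume c hR).ne'
  set ρ : Set Plane → Measure ℝ := fun B => (M.restrict (Prod.fst ⁻¹' B)).map Prod.snd
  have hE : ∀ s : ℝ, Measurable fun t : ℝ => ENNReal.ofReal (Real.exp (-s * t)) := fun s => by
    fun_prop
  -- `ρ B` records the interference seen by the active nodes in `B`. Its transform depends on `B`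
  -- only through the area factor, hence by uniqueness so does `ρ B`.
  have hlap : ∀ B, MeasurableSet B → ∀ s : ℝ, 0 ≤ s →
      ∫⁻ t, ENNReal.ofReal (Real.exp (-s * t)) ∂(ρ B) =
        volume (B ∩ C) * ENNReal.ofReal (a * lam * L s) := by
    intro B hB s hs0
    have hBp : MeasurableSet (Prod.fst ⁻¹' B : Set (Plane × ℝ)) := measurable_fst hB
    have hfm : Measurable ((Prod.fst ⁻¹' B).indicator fun p : Plane × ℝ =>
        ENNReal.ofReal (Real.exp (-s * p.2))) := ((hE s).comp measurable_snd).indicator hBp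
    have hBC : volume (B ∩ C) ≠ ⊤ := measure_ne_top_of_subset Set.inter_subset_right hCtop
    simp only [ρ]
    rw [lintegral_map (hE s) measurable_snd, ← lintegral_indicator hBp,
      hs.lintegral_activeMeasure Pt η σ2 c h R hfm]
    have := hs.lintegral_sum_active_exp_interference hlam ha0 ha1 hm h𝒜fin hs0 Pt η σ2 hh hR hc he
      (hB.inter hC) Set.inter_subset_right
    rw [show a * lam * volume.real (B ∩ C) * laplaceI lam a Pt η σ2 h R m s =
      volume.real (B ∩ C) * (a * lam * L s) by ring, ENNReal.ofReal_mul measureReal_nonneg,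
      ofReal_measureReal hBC] at this
    rw [← this]
    refine lintegral_congr fun ω => Finset.sum_congr rfl fun i hi => ?_
    have hiC : X i ω ∈ C := (Finset.mem_filter.1 hi).2.1
    by_cases hx : X i ω ∈ B
    · rw [Set.indicator_of_mem (by exact hx), Set.indicator_of_mem (show X i ω ∈ B ∩ C from ⟨hx, hiC⟩)]
      simp
    · rw [Set.indicator_of_notMem (by exact hx), Set.indicator_of_notMem
        (show X i ω ∉ B ∩ C from fun h => hx h.1)]
      simp
  have hfin : ∀ B, MeasurableSet B → IsFiniteMeasure (ρ B) := by
    intro B hB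
    -- At `s = 0` the transform is the total mass.
    have h0 := hlap B hB 0 le_rfl
    simp only [neg_zero, zero_mul, Real.exp_zero, ENNReal.ofReal_one, lintegral_one] at h0
    refine ⟨?_⟩
    rw [h0]
    exact ENNReal.mul_lt_top ((measure_mono Set.inter_subset_right).trans_lt hCtop.lt_top)
      ENNReal.ofReal_lt_top
  have hMpos : ∀ᵐ p ∂M, 0 ≤ p.2 := by
    have hmeas : MeasurableSet {p : Plane × ℝ | ¬ 0 ≤ p.2} :=
      (measurableSet_le measurable_const measurable_snd).compl
    rw [ae_iff, ← lintegral_indicator_one hmeas,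
      hs.lintegral_activeMeasure Pt η σ2 c h R (measurable_one.indicator hmeas)]
    refine (lintegral_congr_ae ?_).trans lintegral_zero
    filter_upwards [hs.ae_gain_nonneg] with ω hω
    refine Finset.sum_eq_zero fun i _ => Set.indicator_of_notMem ?_ _
    exact not_not.2 (interference_pos hPt hσ2 c h _ _ hω i).le
  have hpos : ∀ B, ∀ᵐ t ∂(ρ B), 0 ≤ t := fun B =>
    (ae_map_iff measurable_snd.aemeasurable measurableSet_Ici).2 (ae_restrict_of_ae hMpos)
  have hunivfin := hfin Set.univ MeasurableSet.univ
  -- The measure `ν` is the interference measure of all active nodes per unit area of the disk.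
  refine ⟨(volume C)⁻¹ • ρ Set.univ,
    Measure.smul_finite _ (ENNReal.inv_ne_top.2 hC0),
    Measure.ae_smul_measure (hpos _) _, ?_, ?_⟩
  · intro s hs0
    rw [lintegral_smul_measure, hlap _ MeasurableSet.univ s hs0, Set.univ_inter, smul_eq_mul,
      ← mul_assoc, ENNReal.inv_mul_cancel hC0 hCtop, one_mul]
  · have hνfin : IsFiniteMeasure ((volume C)⁻¹ • ρ Set.univ) :=
      Measure.smul_finite _ (ENNReal.inv_ne_top.2 hC0)
    have : IsFiniteMeasure (volume.restrict C) := ⟨by simpa using hCtop.lt_top⟩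
    refine (Measure.prod_eq fun B D hB hD => ?_).symm
    have hBC : volume (B ∩ C) ≠ ⊤ := measure_ne_top_of_subset Set.inter_subset_right hCtop
    have hBfin := hfin B hB
    have hkfin : IsFiniteMeasure (volume (B ∩ C) • (volume C)⁻¹ • ρ Set.univ) :=
      Measure.smul_finite _ hBC
    have heq : ρ B = volume (B ∩ C) • (volume C)⁻¹ • ρ Set.univ := by
      refine measure_ext_of_laplace (hpos B)
        (Measure.ae_smul_measure (Measure.ae_smul_measure (hpos _) _) _) fun s hs0 => ?_
      rw [hlap B hB s hs0, lintegral_smul_measure, lintegral_smul_measure,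
        hlap _ MeasurableSet.univ s hs0, Set.univ_inter, smul_eq_mul, smul_eq_mul,
        ← mul_assoc (volume C)⁻¹, ENNReal.inv_mul_cancel hC0 hCtop, one_mul]
    have hBD : ρ B D = M (B ×ˢ D) := by
      simp only [ρ]
      rw [Measure.map_apply measurable_snd hD, Measure.restrict_apply (measurable_snd hD)]
      congr 1
      ext p
      simp [and_comm]
    rw [← hBD, heq, Measure.restrict_apply hB]
    rfl

end PalmDistribution

/-! ### Derivatives of the Laplace transform as moments -/

section Derivatives

/-- If `ν` is a finite measure on `[0, ∞)` with Laplace transform `L`, the derivatives of `L` are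
the moments of the exponentially tilted measure. -/
lemma integral_pow_mul_exp_eq_iteratedDeriv {ν : Measure ℝ} [IsFiniteMeasure ν]
    (hν : ∀ᵐ t ∂ν, 0 ≤ t) {L : ℝ → ℝ} {K : ℝ} (hL0 : ∀ s, 0 ≤ K * L s)
    (hL : ∀ s : ℝ, 0 ≤ s → ∫⁻ t, ENNReal.ofReal (Real.exp (-s * t)) ∂ν = ENNReal.ofReal (K * L s))
    {s : ℝ} (hs : 0 < s) (k : ℕ) :
    Integrable (fun t => t ^ k * Real.exp (-s * t)) ν ∧
      ∫ t, t ^ k * Real.exp (-s * t) ∂ν = K * ((-1) ^ k * iteratedDeriv k L s) := by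
  have hexp : ∀ u ∈ Set.Iic (0 : ℝ), u ∈ integrableExpSet id ν := by
    intro u hu
    refine (integrable_const (1 : ℝ)).mono' (by fun_prop) (hν.mono fun t ht => ?_)
    rw [Real.norm_of_nonneg (Real.exp_pos _).le]
    exact Real.exp_le_one_iff.2 (mul_nonpos_of_nonpos_of_nonneg hu ht)
  have hint : -s ∈ interior (integrableExpSet id ν) :=
    mem_interior.2 ⟨Set.Iio 0, fun u hu => hexp u (Set.mem_Iic.2 (le_of_lt hu)), isOpen_Iio, neg_lt_zero.2 hs⟩
  refine ⟨integrable_pow_mul_exp_of_mem_interior_integrableExpSet hint k, ?_⟩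
  -- The transform is known only on `[0, ∞)`, but `s > 0` makes the identity local around `s`, so
  -- all derivatives at `s` agree.
  have hloc : (fun u => mgf id ν (-u)) =ᶠ[𝓝 s] fun u => K * L u := by
    filter_upwards [Ioi_mem_nhds hs] with u hu
    have hu0 : (0 : ℝ) ≤ u := le_of_lt hu
    simp only [mgf, id]
    rw [integral_eq_lintegral_of_nonneg_ae (ae_of_all _ fun t => (Real.exp_pos _).le)
      (by fun_prop), hL u hu0, ENNReal.toReal_ofReal (hL0 u)]
  have h1 := hloc.iteratedDeriv_eq k
  rw [iteratedDeriv_comp_neg, iteratedDeriv_const_mul_field, iteratedDeriv_mgf hint k] at h1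
  simp only [id, smul_eq_mul] at h1
  have hsq : ((-1 : ℝ) ^ k) * (-1) ^ k = 1 := by rw [← mul_pow]; simp
  linear_combination (-1 : ℝ) ^ k * h1 - (∫ t, t ^ k * Real.exp (-s * t) ∂ν) * hsq

/-- Each term of the tail is a tilted moment of `ν`, hence a derivative of `L` at `m * b`; its sign
`(-1) ^ k` is absorbed into the power of `-(m * b)`. -/
lemma integral_gammaTail {ν : Measure ℝ} [IsFiniteMeasure ν]
    (hν : ∀ᵐ t ∂ν, 0 ≤ t) {L : ℝ → ℝ} {K : ℝ} (hL0 : ∀ s, 0 ≤ K * L s)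
    (hL : ∀ s : ℝ, 0 ≤ s → ∫⁻ t, ENNReal.ofReal (Real.exp (-s * t)) ∂ν = ENNReal.ofReal (K * L s))
    {m : ℕ} (hm : 1 ≤ m) {b : ℝ} (hb : 0 < b) :
    ∫ t, gammaTail m (b * t) ∂ν =
      K * ∑ k ∈ Finset.range m, (-(m * b)) ^ k / (k.factorial : ℝ) *
        iteratedDeriv k L (m * b) := by
  have hm0 : (0 : ℝ) < m := by exact_mod_cast hm
  have hs : 0 < m * b := mul_pos hm0 hb
  have hmom := integral_pow_mul_exp_eq_iteratedDeriv hν hL0 hL hs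
  have hpt : ∀ t, gammaTail m (b * t) = ∑ k ∈ Finset.range m,
      (m * b) ^ k / (k.factorial : ℝ) * (t ^ k * Real.exp (-(m * b) * t)) := by
    intro t
    refine Finset.sum_congr rfl fun k _ => ?_
    rw [show (m : ℝ) * (b * t) = m * b * t by ring, mul_pow (m * b) t k, neg_mul]
    ring
  have hi : ∀ k ∈ Finset.range m, Integrable (fun t => (m * b) ^ k / (k.factorial : ℝ) *
      (t ^ k * Real.exp (-(m * b) * t))) ν := fun k _ => (hmom k).1.const_mul _
  simp_rw [hpt]
  rw [integral_finsetSum _ hi, Finset.mul_sum]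
  refine Finset.sum_congr rfl fun k _ => ?_
  rw [integral_const_mul, (hmom k).2, neg_pow (m * b : ℝ)]
  ring

end Derivatives

/-! ### The success event and its probability -/

section Success

lemma measurable_theta (R Rmse : ℝ) : Measurable (theta R Rmse) := by
  unfold theta
  refine Measurable.ite ?_ measurable_const (Measurable.ite ?_ ?_ measurable_const)
  · exact measurableSet_Icc (a := (0 : ℝ)) (b := max 0 (Rmse - R))
  · exact measurableSet_Icc (a := |Rmse - R|) (b := Rmse + R)
  · exact measurable_const.mul (Real.measurable_arccos.comp (by fun_prop))

lemma theta_nonneg (R Rmse w : ℝ) : 0 ≤ theta R Rmse w := by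
  unfold theta
  split_ifs
  · positivity
  · exact mul_nonneg zero_le_two (Real.arccos_nonneg _)
  · exact le_rfl

lemma droneDist_pos {h : ℝ} (hh : 0 < h) (c x : Plane) : 0 < droneDist c h x :=
  Real.sqrt_pos.2 (by positivity)

lemma sinr_eq {Pt : ℝ} (hPt : 0 < Pt) (η σ2 : ℝ) (c : Plane) (h : ℝ) (S : Finset ℕ)
    (x : ℕ → Plane) (g : ℕ → ℝ) (i : ℕ) :
    sinr Pt η σ2 c h S x g i =
      g i * droneDist c h (x i) ^ (-η) / interference Pt η σ2 c h S x g i := by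
  have : ∑ j ∈ S.erase i, Pt * g j * droneDist c h (x j) ^ (-η) + σ2 =
      Pt * interference Pt η σ2 c h S x g i := by
    unfold interference
    rw [mul_add, Finset.mul_sum, mul_div_cancel₀ _ hPt.ne']
    congr 1
    exact Finset.sum_congr rfl fun j _ => by ring
  rw [sinr, this, mul_assoc, mul_div_mul_left _ _ hPt.ne']

/-- Isolates the node's own gain: the threshold on the right does not involve `g i`. -/
lemma le_sinr_iff {Pt σ2 h : ℝ} (hPt : 0 < Pt) (hσ2 : 0 < σ2) (hh : 0 < h) (η β : ℝ) (c : Plane)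
    (S : Finset ℕ) (x : ℕ → Plane) {g : ℕ → ℝ} (hg : ∀ i, 0 ≤ g i) (i : ℕ) :
    β ≤ sinr Pt η σ2 c h S x g i ↔
      β * droneDist c h (x i) ^ η * interference Pt η σ2 c h S x g i ≤ g i := by
  have hI := interference_pos (η := η) hPt hσ2 c h S x hg i
  have hD : 0 < droneDist c h (x i) ^ η := Real.rpow_pos_of_pos (droneDist_pos hh c _) _
  rw [sinr_eq hPt, le_div_iff₀ hI, Real.rpow_neg (droneDist_nonneg c h _), ← div_eq_mul_inv,
    le_div_iff₀ hD, mul_right_comm]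

/-- For a threshold of at least one, at most one node can be received successfully. -/
lemma eq_of_le_sinr {Pt σ2 h β : ℝ} (hPt : 0 < Pt) (hσ2 : 0 < σ2) (hβ : 1 ≤ β) (η : ℝ)
    (c : Plane) {S : Finset ℕ} (x : ℕ → Plane) {g : ℕ → ℝ} (hg : ∀ i, 0 ≤ g i) {i j : ℕ}
    (hi : i ∈ S) (hj : j ∈ S) (hβi : β ≤ sinr Pt η σ2 c h S x g i)
    (hβj : β ≤ sinr Pt η σ2 c h S x g j) : i = j := by
  set p : ℕ → ℝ := fun k => g k * droneDist c h (x k) ^ (-η)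
  have hp : ∀ k, 0 ≤ p k := fun k =>
    mul_nonneg (hg k) (Real.rpow_nonneg (droneDist_nonneg c h _) _)
  -- The power of a successful node is at least `β ≥ 1` times the interference plus noise, which
  -- strictly exceeds any single interferer because the noise is positive.
  have key : ∀ k l, l ∈ S → l ≠ k → β ≤ sinr Pt η σ2 c h S x g k → p l < p k := by
    intro k l hl hlk hβk
    have hI := interference_pos (η := η) hPt hσ2 c h S x hg k
    rw [sinr_eq hPt, le_div_iff₀ hI] at hβk
    have h1 : p l ≤ ∑ j ∈ S.erase k, p j :=
      Finset.single_le_sum (fun j _ => hp j) (Finset.mem_erase.2 ⟨hlk, hl⟩)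
    have h2 : p l < interference Pt η σ2 c h S x g k :=
      lt_add_of_le_of_pos h1 (div_pos hσ2 hPt)
    exact h2.trans_le ((le_mul_of_one_le_left hI.le hβ).trans hβk)
  by_contra hij
  exact lt_asymm (key i j hj (Ne.symm hij) hβi) (key j i hi hij hβj)

lemma IsSlot.measurable_sum_active {Ω : Type*} [MeasurableSpace Ω] {Pr : Measure Ω}
    {lam a : ℝ} {m : ℕ} {𝒜 : Set Plane}
    {N : Ω → ℕ} {X : ℕ → Ω → Plane} {T : ℕ → Ω → Bool} {G : ℕ → Ω → ℝ}
    (hs : IsSlot Pr lam a m 𝒜 N X T G) (c : Plane) (R : ℝ)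
    {f : ℕ → Ω → ℝ} (hf : ∀ i, Measurable (f i)) :
    Measurable fun ω => ∑ i ∈ active c R (N ω) (fun j => X j ω) (fun j => T j ω), f i ω := by
  classical
  refine measurable_of_measurable_fixed_count hs.nodes.measurable_number
    (f := fun k ω => ∑ i ∈ active c R k (fun j => X j ω) (fun j => T j ω), f i ω) fun k => ?_
  simp only [active, Finset.sum_filter]
  refine Finset.measurable_fun_sum _ fun i _ => Measurable.ite ?_ (hf i) measurable_const
  exact (hs.nodes.measurable_position i Metric.isClosed_closedBall.measurableSet).inter
    (hs.measurable_decision i (measurableSet_singleton true))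

end Success

section SuccessProbability

variable {Ω : Type*} [MeasurableSpace Ω] {Pr : Measure Ω} [IsProbabilityMeasure Pr]
  {lam a : ℝ} {m : ℕ} {𝒜 : Set Plane}
  {N : Ω → ℕ} {X : ℕ → Ω → Plane} {T : ℕ → Ω → Bool} {G : ℕ → Ω → ℝ}

open Classical in
/-- The success event has the probability given by the Campbell measure of the active nodes. -/
lemma IsSlot.measure_exists_le_sinr (hs : IsSlot Pr lam a m 𝒜 N X T G)
    {Pt σ2 h β : ℝ} (hPt : 0 < Pt) (hσ2 : 0 < σ2) (hh : 0 < h) (hβ : 1 ≤ β) (η R : ℝ)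
    (c : Plane) {A : Set Plane} (hA : MeasurableSet A) :
    Pr {ω | ∃ i ∈ active c R (N ω) (fun j => X j ω) (fun j => T j ω), X i ω ∈ A ∧
        β ≤ sinr Pt η σ2 c h (active c R (N ω) (fun j => X j ω) (fun j => T j ω))
          (fun j => X j ω) (fun j => G j ω) i} =
      ∫⁻ p, A.indicator 1 p.1 * gammaMeasure m m (Set.Ici (β * droneDist c h p.1 ^ η * p.2))
        ∂(activeMeasure Pr Pt η σ2 c h R N X T G) := by
  set act : Ω → Finset ℕ := fun ω => active c R (N ω) (fun j => X j ω) (fun j => T j ω)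
  set I : ℕ → Ω → ℝ := fun i ω =>
    interference Pt η σ2 c h (act ω) (fun j => X j ω) (fun j => G j ω) i
  have hI : ∀ i, Measurable (I i) := hs.measurable_interference Pt η σ2 c h R
  have hD : Measurable (droneDist c h) := measurable_droneDist c h
  set f : Plane × ℝ → ℝ → ENNReal := fun p g =>
    A.indicator 1 p.1 * (Set.Ici (β * droneDist c h p.1 ^ η * p.2)).indicator 1 g
  have hf : Measurable (Function.uncurry f) := by
    refine ((measurable_one.indicator hA).comp (measurable_fst.comp measurable_fst)).mul ?_
    have : MeasurableSet {q : (Plane × ℝ) × ℝ | β * droneDist c h q.1.1 ^ η * q.1.2 ≤ q.2} :=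
      measurableSet_le (by fun_prop) (by fun_prop)
    exact measurable_one.indicator this
  have hright : ∀ p : Plane × ℝ, ∫⁻ g, f p g ∂(gammaMeasure m m) =
      A.indicator 1 p.1 * gammaMeasure m m (Set.Ici (β * droneDist c h p.1 ^ η * p.2)) := by
    intro p
    simp only [f]
    rw [lintegral_const_mul _ (measurable_one.indicator measurableSet_Ici),
      lintegral_indicator_one measurableSet_Ici]
  simp_rw [← hright]
  rw [← hs.lintegral_sum_active_gain Pt η σ2 c h R hf]
  -- A measurable version of the success event; the two agree where all gains are nonnegative, which
  -- holds almost surely.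
  set E : Set Ω := ⋃ i, {ω | i ∈ act ω} ∩ (X i ⁻¹' A ∩
    {ω | β * droneDist c h (X i ω) ^ η * I i ω ≤ G i ω})
  have hE : MeasurableSet E := MeasurableSet.iUnion fun i =>
    (hs.measurableSet_active c R i).inter ((hs.nodes.measurable_position i hA).inter
      (measurableSet_le (((hD.comp (hs.nodes.measurable_position i)).pow_const η |>.const_mul
        β).mul (hI i)) (hs.measurable_gain i)))
  have hEae : {ω | ∃ i ∈ act ω, X i ω ∈ A ∧
      β ≤ sinr Pt η σ2 c h (act ω) (fun j => X j ω) (fun j => G j ω) i} =ᵐ[Pr] E := by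
    filter_upwards [hs.ae_gain_nonneg] with ω hω
    refine propext ?_
    change (∃ i ∈ act ω, X i ω ∈ A ∧ _) ↔ ω ∈ E
    simp only [E, Set.mem_iUnion]
    refine exists_congr fun i => and_congr_right fun _ => and_congr_right fun _ => ?_
    exact le_sinr_iff hPt hσ2 hh η β c (act ω) (fun j => X j ω) hω i
  rw [measure_congr hEae, ← lintegral_indicator_one hE]
  refine lintegral_congr_ae ?_
  filter_upwards [hs.ae_gain_nonneg] with ω hω
  have hval : ∀ i, f (X i ω, I i ω) (G i ω) =
      if X i ω ∈ A ∧ β ≤ sinr Pt η σ2 c h (act ω) (fun j => X j ω) (fun j => G j ω) i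
      then 1 else 0 := by
    intro i
    simp only [f, le_sinr_iff hPt hσ2 hh η β c (act ω) (fun j => X j ω) hω i]
    by_cases h1 : X i ω ∈ A <;>
      by_cases h2 : β * droneDist c h (X i ω) ^ η * I i ω ≤ G i ω <;>
      simp [h1, I, h2]
  change _ = ∑ i ∈ act ω, f (X i ω, I i ω) (G i ω)
  simp_rw [hval]
  -- Since at most one node succeeds, the indicator of the union equals the sum of the indicators.
  by_cases hω' : ω ∈ E
  · rw [Set.indicator_of_mem hω']
    obtain ⟨i, hi, hiA, hiβ⟩ := Set.mem_iUnion.1 hω'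
    have hiβ' := (le_sinr_iff hPt hσ2 hh η β c (act ω) (fun j => X j ω) hω i).2 hiβ
    rw [Finset.sum_eq_single_of_mem i hi, if_pos ⟨hiA, hiβ'⟩]
    · rfl
    · intro j hj hji
      refine if_neg fun hjβ => hji ?_
      exact eq_of_le_sinr hPt hσ2 hβ η c (fun j => X j ω) hω hj hi hjβ.2 hiβ'
  · rw [Set.indicator_of_notMem hω']
    refine (Finset.sum_eq_zero fun i hi => if_neg fun hiβ => hω' ?_).symm
    exact Set.mem_iUnion.2 ⟨i, hi, hiβ.1,
      (le_sinr_iff hPt hσ2 hh η β c (act ω) (fun j => X j ω) hω i).1 hiβ.2⟩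

end SuccessProbability

end UAV

end

/-! ### Assembly of the theorem -/

theorem theorem2 {Ω : Type*} [MeasurableSpace Ω] (Pr : Measure Ω) [IsProbabilityMeasure Pr]
    (lam a Pt η σ2 h R Rmse β : ℝ) (m : ℕ)
    (hlam : 0 < lam) (ha0 : 0 ≤ a) (ha1 : a ≤ 1) (hPt : 0 < Pt) (hη : 0 < η) (hσ2 : 0 < σ2)
    (hh : 0 < h) (hR : 0 < R) (hRmse : 0 < Rmse) (hβ : 1 ≤ β) (hm : 1 ≤ m)
    (𝒜 : Set UAV.Plane) (h𝒜 : MeasurableSet 𝒜) (h𝒜fin : volume 𝒜 ≠ ⊤)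
    -- `c` is the centre of the hovering disk, `e` a point on its edge
    (c e : UAV.Plane) (hc : Metric.closedBall c R ⊆ 𝒜) (he : dist e c = R)
    (N : Ω → ℕ) (X : ℕ → Ω → UAV.Plane) (T : ℕ → Ω → Bool) (G : ℕ → Ω → ℝ)
    (hmodel : UAV.IsSlot Pr lam a m 𝒜 N X T G) :
    -- the probability of a successful transmission from the intersection of the two disks
    Pr.real {ω | ∃ i ∈ UAV.active c R (N ω) (fun j => X j ω) (fun j => T j ω),
        X i ω ∈ Metric.closedBall e Rmse ∩ Metric.closedBall c R ∧
        β ≤ UAV.sinr Pt η σ2 c h (UAV.active c R (N ω) (fun j => X j ω) (fun j => T j ω))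
          (fun j => X j ω) (fun j => G j ω) i} =
      a * lam * ∫ r in h..√(h ^ 2 + R ^ 2),
        (∑ k ∈ Finset.range m, (-(m * β * r ^ η)) ^ k / (k.factorial : ℝ) *
          iteratedDeriv k (UAV.laplaceI lam a Pt η σ2 h R m) (m * β * r ^ η)) *
        r * UAV.theta R Rmse (√(r ^ 2 - h ^ 2)) ∧
    -- `laplaceI` is the Laplace transform of the normalized interference plus noise seen by the
    -- signal of an active node, whatever the position of that node (Palm distribution)
    ∀ s : ℝ, 0 ≤ s → ∀ B : Set UAV.Plane, MeasurableSet B → B ⊆ Metric.closedBall c R →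
      ∫ ω, ∑ i ∈ UAV.active c R (N ω) (fun j => X j ω) (fun j => T j ω),
          B.indicator (fun _ => Real.exp (-s * UAV.interference Pt η σ2 c h
            (UAV.active c R (N ω) (fun j => X j ω) (fun j => T j ω))
            (fun j => X j ω) (fun j => G j ω) i)) (X i ω) ∂Pr =
        a * lam * volume.real B * UAV.laplaceI lam a Pt η σ2 h R m s := by
  have hKL : ∀ s, 0 ≤ a * lam * UAV.laplaceI lam a Pt η σ2 h R m s := fun s =>
    mul_nonneg (mul_nonneg ha0 hlam.le) (UAV.laplaceI_pos _ _ _ _ _ _ _ _ _).le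
  refine ⟨?_, fun s hs B hB hBc => ?_⟩
  · obtain ⟨ν, hνfin, hνpos, hνL, hprod⟩ := hmodel.exists_activeMeasure_eq_prod hlam.le ha0 ha1 hm
      h𝒜fin hPt hσ2 η hh hR hc he
    set A := Metric.closedBall e Rmse ∩ Metric.closedBall c R
    have hA : MeasurableSet A := Metric.isClosed_closedBall.measurableSet.inter
      Metric.isClosed_closedBall.measurableSet
    have hm0 : (0 : ℝ) < m := by exact_mod_cast hm
    have hγ := isProbabilityMeasure_gammaMeasure hm0 hm0
    set F : ℝ → ENNReal := fun r => ∫⁻ t, gammaMeasure m m (Set.Ici (β * r ^ η * t)) ∂ν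
    have hγm : Measurable fun u : ℝ => gammaMeasure m m (Set.Ici u) :=
      Antitone.measurable fun u v huv => measure_mono (Set.Ici_subset_Ici.2 huv)
    have hF : Measurable F := Measurable.lintegral_prod_right'
      (f := fun p : ℝ × ℝ => gammaMeasure m m (Set.Ici (β * p.1 ^ η * p.2)))
      (hγm.comp (by fun_prop))
    have hD := UAV.measurable_droneDist c h
    set Q : ℝ → ℝ := fun r => ∑ k ∈ Finset.range m,
      (-(m * β * r ^ η)) ^ k / (k.factorial : ℝ) *
        iteratedDeriv k (UAV.laplaceI lam a Pt η σ2 h R m) (m * β * r ^ η)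
    have hFtop : ∀ r, F r ≠ ⊤ := fun r => ((lintegral_mono fun t => prob_le_one).trans_lt
      (by simp)).ne
    -- `F r` is the Gamma tail at `b * t`, with `b = β * r ^ η`, integrated over `ν`; `a * lam` is
    -- the constant in the transform of `ν`.
    have hQF : ∀ r, 0 < r → a * lam * Q r = (F r).toReal := by
      intro r hr
      have hb : 0 < β * r ^ η := mul_pos (one_pos.trans_le hβ) (Real.rpow_pos_of_pos hr _)
      have h1 := UAV.integral_gammaTail hνpos hKL hνL hm hb
      rw [← mul_assoc] at h1
      rw [← h1, integral_eq_lintegral_of_nonneg_ae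
        (hνpos.mono fun t ht => UAV.gammaTail_nonneg m (mul_nonneg hb.le ht))
        ((UAV.measurable_gammaTail m).comp (by fun_prop)).aestronglyMeasurable]
      congr 1
      refine lintegral_congr_ae (hνpos.mono fun t ht => ?_)
      exact (UAV.gammaMeasure_Ici hm (mul_nonneg hb.le ht)).symm
    have hPr : Pr {ω | ∃ i ∈ UAV.active c R (N ω) (fun j => X j ω) (fun j => T j ω), X i ω ∈ A ∧
        β ≤ UAV.sinr Pt η σ2 c h (UAV.active c R (N ω) (fun j => X j ω) (fun j => T j ω))
          (fun j => X j ω) (fun j => G j ω) i} =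
        ∫⁻ r in Set.Ioo h (√(h ^ 2 + R ^ 2)),
          ENNReal.ofReal r * (F r * ENNReal.ofReal (UAV.theta R Rmse (√(r ^ 2 - h ^ 2)))) := by
      have hmeas : Measurable fun p : UAV.Plane × ℝ => A.indicator (1 : UAV.Plane → ENNReal) p.1 *
          gammaMeasure m m (Set.Ici (β * UAV.droneDist c h p.1 ^ η * p.2)) :=
        ((measurable_one.indicator hA).comp measurable_fst).mul (hγm.comp (by fun_prop))
      -- By the product form, integrating out the interference leaves a function of the drone
      -- distance alone, to be integrated over the lens.
      rw [hmodel.measure_exists_le_sinr hPt hσ2 hh hβ η R c hA, hprod,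
        lintegral_prod _ hmeas.aemeasurable, ← UAV.lintegral_lens hh hR hRmse he hF]
      have hin : ∀ x, ∫⁻ t, A.indicator (1 : UAV.Plane → ENNReal) x *
          gammaMeasure m m (Set.Ici (β * UAV.droneDist c h x ^ η * t)) ∂ν =
          A.indicator (fun x => F (UAV.droneDist c h x)) x := by
        intro x
        by_cases hx : x ∈ A <;> simp [hx, F]
      simp_rw [hin]
      rw [lintegral_indicator hA, Measure.restrict_restrict hA,
        Set.inter_eq_left.2 (Set.inter_subset_right : A ⊆ Metric.closedBall c R)]
    have hle : h ≤ √(h ^ 2 + R ^ 2) := Real.le_sqrt_of_sq_le (by nlinarith)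
    have hθ : Measurable fun r => UAV.theta R Rmse (√(r ^ 2 - h ^ 2)) :=
      (UAV.measurable_theta R Rmse).comp (by fun_prop)
    rw [measureReal_def, hPr, intervalIntegral.integral_of_le hle, integral_Ioc_eq_integral_Ioo,
      ← integral_const_mul]
    have hcongr : ∀ r ∈ Set.Ioo h (√(h ^ 2 + R ^ 2)),
        a * lam * (Q r * r * UAV.theta R Rmse (√(r ^ 2 - h ^ 2))) =
          r * ((F r).toReal * UAV.theta R Rmse (√(r ^ 2 - h ^ 2))) := by
      intro r hr
      rw [← hQF r (hh.trans hr.1)]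
      ring
    rw [setIntegral_congr_fun measurableSet_Ioo hcongr, integral_eq_lintegral_of_nonneg_ae]
    · congr 1
      refine setLIntegral_congr_fun measurableSet_Ioo fun r hr => ?_
      rw [ENNReal.ofReal_mul (hh.trans hr.1).le, ENNReal.ofReal_mul ENNReal.toReal_nonneg,
        ENNReal.ofReal_toReal (hFtop r)]
    · refine (ae_restrict_iff' measurableSet_Ioo).2 (ae_of_all _ fun r hr => ?_)
      exact mul_nonneg (hh.trans hr.1).le
        (mul_nonneg ENNReal.toReal_nonneg (UAV.theta_nonneg _ _ _))
    · exact (measurable_id.mul (hF.ennreal_toReal.mul hθ)).aestronglyMeasurable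
  · have hI := hmodel.measurable_interference Pt η σ2 c h R
    have hnonneg : ∀ ω i, 0 ≤ B.indicator (fun _ => Real.exp (-s * UAV.interference Pt η σ2 c h
        (UAV.active c R (N ω) (fun j => X j ω) (fun j => T j ω))
        (fun j => X j ω) (fun j => G j ω) i)) (X i ω) := fun ω i =>
      Set.indicator_nonneg (fun _ _ => (Real.exp_pos _).le) _
    have hmeas : ∀ i, Measurable fun ω => B.indicator
        (fun _ => Real.exp (-s * UAV.interference Pt η σ2 c h
          (UAV.active c R (N ω) (fun j => X j ω) (fun j => T j ω))
          (fun j => X j ω) (fun j => G j ω) i)) (X i ω) := fun i =>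
      (((hI i).const_mul (-s)).exp).indicator (hmodel.nodes.measurable_position i hB)
    rw [integral_eq_lintegral_of_nonneg_ae
      (ae_of_all _ fun ω => Finset.sum_nonneg fun i _ => hnonneg ω i)
      (hmodel.measurable_sum_active c R hmeas).aestronglyMeasurable]
    have hKB : 0 ≤ a * lam * volume.real B * UAV.laplaceI lam a Pt η σ2 h R m s :=
      mul_nonneg (by positivity) (UAV.laplaceI_pos _ _ _ _ _ _ _ _ _).le
    rw [← ENNReal.toReal_ofReal hKB, ← hmodel.lintegral_sum_active_exp_interference hlam.le ha0 ha1
      hm h𝒜fin hs Pt η σ2 hh hR hc he hB hBc]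
    congr 1
    refine lintegral_congr fun ω => ?_
    rw [ENNReal.ofReal_sum_of_nonneg fun i _ => hnonneg ω i]
    refine Finset.sum_congr rfl fun i _ => ?_
    by_cases hx : X i ω ∈ B <;> simp [hx]
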